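/- Let $d\ge 3$ and let $\Gamma$ be a finitely generated group with a symmetric generating set $\mathcal S$, $|\mathcal S|=d$, whose left Cayley graph (vertex set $\Gamma$, with an edge between $x$ and $y$ iff $yx^{-1}\in\mathcal S$) is the infinite $d$-regular tree. Let $e$ be the identity and $\rho$ the graph distance (word metric). Let $p\in[0,1)$, and let $(w_n)_{n\ge0}$ be the elephant random walk on this graph with memory parameter $p$: $w_0=e$ and $w_n=g_n\cdots g_1$, where $g_1$ is uniform on $\mathcal S$ and, for $n\ge1$, given $g_1,\dots,g_n$, one chooses $D$ uniformly from $\{1,\dots,n\}$ and lets $g_{n+1}=g_D$ with probability $p$, and $g_{n+1}=a$ with probability $\frac{1-p}{d-1}$ for each $a\in\mathcal S\setminus\{g_D\}$. Let $\Delta_n=\rho(w_n,e)$. If $w_n\ne e$, let $\gamma_n\in\mathcal S$ be the unique step with $\rho(\gamma_n w_n,e)=\Delta_n-1$, and put $\ell_n=\#\{1\le k\le n: g_k=\gamma_n\}$; if $w_n=e$, put $\ell_n=0$. With the convention $\ell_0/0=0$, set $$\Xi_n=\frac1n\sum_{k=0}^{n-1}\Big(\frac{\ell_k}{k}-\frac{\mathbf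 1(\Delta_k>0)}{d}\Big).$$ Then, as $n\to\infty$, $$\sqrt n\,\Big[\frac{\Delta_n}{n}-\frac{d-2}{d}-\frac{2(1-pd)}{d-1}\,\Xi_n\Big]\ \xrightarrow{\ d\ }\ N\Big(0,\frac{4(d-1)}{d^2}\Big).$$ -/

import Mathlib

open MeasureTheory ProbabilityTheory Filter

noncomputable section

namespace ElephantWalk

/-- The (left) Cayley graph of a group with respect to a set `S`. For symmetric `S` not
containing `1`, there is an edge between `x` and `y` iff `y * x⁻¹ ∈ S`. -/
def leftCayley {Γ : Type*} [Group Γ] (S : Set Γ) : SimpleGraph Γ :=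
  SimpleGraph.fromRel (fun x y => y * x⁻¹ ∈ S)

/-- The graph `G` is (isomorphic to) the `d`-regular tree: it is connected, has no cycle, and
every vertex has exactly `d` neighbours (`d ≥ 1`). -/
structure IsRegularTree {V : Type*} (G : SimpleGraph V) (d : ℕ) : Prop where
  isTree : G.IsTree
  degree_eq : ∀ v : V, (G.neighborSet v).ncard = d

variable {Γ : Type*} [Group Γ]

/-- The word metric: the distance in the Cayley graph. -/
def wordDist (S : Finset Γ) (x y : Γ) : ℕ :=
  (leftCayley (S : Set Γ)).dist x y

/-- The position `w_n = g_n ⋯ g_1` after `n` steps; the sequence `s` lists the steps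
`g_1, g_2, …` starting at index `0`, so that `s k` is `g_{k+1}`. -/
def position {S : Finset Γ} (s : ℕ → S) : ℕ → Γ
  | 0 => 1
  | n + 1 => (s n : Γ) * position s n

/-- The distance `Δ_n` from the root after `n` steps. -/
def distRoot {S : Finset Γ} (s : ℕ → S) (n : ℕ) : ℕ :=
  wordDist S (position s n) 1

/-- The number `N_n(a)` of `a`-steps among the first `n` steps. -/
def stepCount {S : Finset Γ} (s : ℕ → S) (n : ℕ) (a : Γ) : ℕ :=
  {k : ℕ | k < n ∧ (s k : Γ) = a}.ncard

open Classical in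
/-- The step `γ` in `S` which, taken at the position `w ≠ 1`, decreases the distance to the root
by `1` (on a tree there is exactly one). The value `1` is returned if there is no such step. -/
def rootStep (S : Finset Γ) (w : Γ) : Γ :=
  if h : ∃ a ∈ S, wordDist S (a * w) 1 + 1 = wordDist S w 1 then h.choose else 1

open Classical in
/-- `ℓ_n = N_n(γ_n)` if `w_n ≠ e`, and `ℓ_n = 0` otherwise. -/
def ell {S : Finset Γ} (s : ℕ → S) (n : ℕ) : ℕ :=
  if position s n ≠ 1 then stepCount s n (rootStep S (position s n)) else 0

/-- `Ξ_n = (1/n) ∑_{k<n} (ℓ_k / k - 1(Δ_k > 0) / d)`, where `d = |S|` and `ℓ_0 / 0 = 0`. -/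
def Xi {S : Finset Γ} (s : ℕ → S) (n : ℕ) : ℝ :=
  (1 / (n : ℝ)) * ∑ k ∈ Finset.range n,
    ((ell s k : ℝ) / (k : ℝ) - (if 0 < distRoot s k then (1 : ℝ) else 0) / (S.card : ℝ))

/-- The steps of an elephant random walk with memory parameter `p`. The first step `g 0` is
uniform on `S`. Given the steps `g 0, …, g n`, a uniform random index `D n ∈ {0, …, n}` is chosen,
and the next step `g (n + 1)` is the remembered step `g (D n)` with probability `p`, and each of
the other `|S| - 1` elements of `S` with probability `(1 - p) / (|S| - 1)`. -/
structure IsElephantWalk (S : Finset Γ) (p : ℝ) {Ω : Type*} [MeasurableSpace Ω]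
    (μ : Measure Ω) (g : ℕ → Ω → S) (D : (n : ℕ) → Ω → Fin (n + 1)) : Prop where
  measurable_step : ∀ (n : ℕ) (a : S), MeasurableSet {ω | g n ω = a}
  measurable_index : ∀ (n : ℕ) (j : Fin (n + 1)), MeasurableSet {ω | D n ω = j}
  first_step : ∀ a : S, μ.real {ω | g 0 ω = a} = 1 / (S.card : ℝ)
  index_uniform : ∀ (n : ℕ) (x : Fin (n + 1) → S) (j : Fin (n + 1)),
    μ.real {ω | (∀ i : Fin (n + 1), g i ω = x i) ∧ D n ω = j} =
      μ.real {ω | ∀ i : Fin (n + 1), g i ω = x i} * (1 / ((n : ℝ) + 1))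
  repeat_step : ∀ (n : ℕ) (x : Fin (n + 1) → S) (j : Fin (n + 1)),
    μ.real {ω | (∀ i : Fin (n + 1), g i ω = x i) ∧ D n ω = j ∧ g (n + 1) ω = x j} =
      μ.real {ω | (∀ i : Fin (n + 1), g i ω = x i) ∧ D n ω = j} * p
  other_step : ∀ (n : ℕ) (x : Fin (n + 1) → S) (j : Fin (n + 1)) (a : S), a ≠ x j →
    μ.real {ω | (∀ i : Fin (n + 1), g i ω = x i) ∧ D n ω = j ∧ g (n + 1) ω = a} =
      μ.real {ω | (∀ i : Fin (n + 1), g i ω = x i) ∧ D n ω = j} *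
        ((1 - p) / ((S.card : ℝ) - 1))

end ElephantWalk

end

/-! Write $N_n(a)$ for the number of $a$-steps up to time $n$. On a tree each step changes the
distance to the root by $\pm1$, and away from the root exactly one step, $\gamma_n$, decreases it.
For $n\ge1$, averaging over the remembered index gives conditional step probabilities
$\frac1d+\frac{pd-1}{d-1}\bigl(\frac{N_n(a)}n-\frac1d\bigr)$. The conditional drift of $\Delta_n$ is
therefore $\frac{d-2}d$ plus $\frac{2(1-pd)}{d-1}$ times the summand of $\Xi_n$, with an extra
$\frac2d$ at the root. Summing (`sqrt_mul_eq`), the quantity in the theorem equals exactly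
$M_n/\sqrt n+\frac2d V_n/\sqrt n$, where $M_n$ is a martingale with bounded increments and $V_n$
counts visits to the root.

Two facts remain. The frequencies $N_n(a)/n$ tend to $1/d$ almost surely
(`ae_tendsto_stepCount_div`): since $p<1$, the centred counts have second moment $O(n^{1+\beta})$
with $\beta<1$. As also $M_n/n\to0$, a late return to the root would contradict the positive
limiting drift (`eventually_position_ne_one`), so $V_n$ is bounded along almost every path. The
conditional variances $1-\mathrm{drift}^2$ then converge to $1-(\frac{d-2}d)^2=\frac{4(d-1)}{d^2}$.

The martingale central limit theorem (`IsMartDiff.tendstoInDistribution`) comes from characteristic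
functions: with $Q_n$ the sum of the conditional variances, $\exp(i\varphi M_n+\varphi^2Q_n/2)$ has
expectation near 1. All conditioning is done by finite sums over step histories. -/

namespace ElephantWalk

/-! ### Functionals of finitely many steps and one-step conditioning -/

section StepChain

variable {A : Type*} {Ω : Type*} [MeasurableSpace Ω]

/-- A process `g` with values in a finite type such that, given the first `n` values, the
probability that the next value is `a` is `q n g a`, a function of these first `n` values. -/
structure StepChain [Fintype A] (μ : Measure Ω) (g : ℕ → Ω → A) (q : ℕ → (ℕ → A) → A → ℝ) :
    Prop where
  measurable_step : ∀ n a, MeasurableSet {ω | g n ω = a}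
  dependsOn : ∀ n a, DependsOn (fun s => q n s a) (Set.Iio n)
  nonneg : ∀ n s a, 0 ≤ q n s a
  sum_eq_one : ∀ n s, ∑ a, q n s a = 1
  step : ∀ n (x : ℕ → A) a, μ.real {ω | (∀ i < n, g i ω = x i) ∧ g n ω = a} =
    μ.real {ω | ∀ i < n, g i ω = x i} * q n x a

/-- Extend a finite sequence by a constant. -/
noncomputable def extendSeq [Nonempty A] {n : ℕ} (x : Fin n → A) : ℕ → A :=
  fun k => if h : k < n then x ⟨k, h⟩ else Classical.arbitrary A

-- Factors the functional through `Fin n → A`. For finite `A` this makes measurability, boundedness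
-- and integrability automatic.
omit [MeasurableSpace Ω] in
lemma _root_.DependsOn.comp_steps [Nonempty A] {E : Type*} {n : ℕ} {F : (ℕ → A) → E}
    (hF : DependsOn F (Set.Iio n)) (g : ℕ → Ω → A) (ω : Ω) :
    F (fun k => g k ω) = F (extendSeq fun i : Fin n => g i ω) := by
  refine hF fun i hi => ?_
  simp only [Set.mem_Iio] at hi
  simp [extendSeq, hi]

lemma measurable_steps [Finite A] {g : ℕ → Ω → A} (hg : ∀ n a, MeasurableSet {ω | g n ω = a})
    (n : ℕ) : @Measurable _ _ _ ⊤ (fun ω (i : Fin n) => g i ω) := by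
  let _ : MeasurableSpace A := ⊤
  have h : Measurable (fun ω (i : Fin n) => g i ω) :=
    measurable_pi_lambda _ fun i => measurable_to_countable' fun a => hg i a
  intro t _
  exact h (Set.toFinite t).measurableSet

variable [Finite A] [Nonempty A] {E : Type*} {g : ℕ → Ω → A}

lemma _root_.DependsOn.stronglyMeasurable [TopologicalSpace E] {n : ℕ} {F : (ℕ → A) → E}
    (hF : DependsOn F (Set.Iio n)) (hg : ∀ n a, MeasurableSet {ω | g n ω = a}) :
    StronglyMeasurable fun ω => F fun k => g k ω := by
  simp_rw [hF.comp_steps g]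
  let _ : MeasurableSpace (Fin n → A) := ⊤
  have : StronglyMeasurable fun x : Fin n → A => F (extendSeq x) := .of_discrete
  exact this.comp_measurable (measurable_steps hg n)

lemma _root_.DependsOn.exists_norm_le [NormedAddCommGroup E] {n : ℕ} {F : (ℕ → A) → E}
    (hF : DependsOn F (Set.Iio n)) : ∃ C, ∀ s, ‖F s‖ ≤ C := by
  obtain ⟨C, hC⟩ := (Set.finite_range fun x : Fin n → A => ‖F (extendSeq x)‖).bddAbove
  refine ⟨C, fun s => ?_⟩
  have h := hF.comp_steps (fun k (s : ℕ → A) => s k) s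
  rw [h]
  exact hC ⟨_, rfl⟩

lemma _root_.DependsOn.integrable [NormedAddCommGroup E] {n : ℕ} {F : (ℕ → A) → E}
    (hF : DependsOn F (Set.Iio n)) (hg : ∀ n a, MeasurableSet {ω | g n ω = a})
    (μ : Measure Ω) [IsFiniteMeasure μ] : Integrable (fun ω => F fun k => g k ω) μ := by
  obtain ⟨C, hC⟩ := hF.exists_norm_le
  exact .of_bound (hF.stronglyMeasurable hg).aestronglyMeasurable C
    (.of_forall fun ω => hC _)

end StepChain

section Integral

variable {A : Type*} [Fintype A] [Nonempty A] {Ω : Type*} [MeasurableSpace Ω]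
  {E : Type*} [NormedAddCommGroup E] [NormedSpace ℝ E] [CompleteSpace E] {g : ℕ → Ω → A}

open Classical in
lemma _root_.DependsOn.integral_eq_sum {n : ℕ} {F : (ℕ → A) → E}
    (hF : DependsOn F (Set.Iio n)) (hg : ∀ n a, MeasurableSet {ω | g n ω = a})
    (μ : Measure Ω) [IsFiniteMeasure μ] :
    ∫ ω, F (fun k => g k ω) ∂μ =
      ∑ x : Fin n → A, μ.real {ω | ∀ i < n, g i ω = extendSeq x i} • F (extendSeq x) := by
  let _ : MeasurableSpace (Fin n → A) := ⊤
  have hm : Measurable fun ω (i : Fin n) => g i ω := measurable_steps hg n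
  simp_rw [hF.comp_steps g]
  rw [← integral_map (φ := fun ω (i : Fin n) => g i ω) (f := fun x => F (extendSeq x))
    hm.aemeasurable StronglyMeasurable.of_discrete.aestronglyMeasurable,
    integral_fintype Integrable.of_finite]
  refine Finset.sum_congr rfl fun x _ => ?_
  rw [map_measureReal_apply hm trivial]
  congr 2
  ext ω
  simp only [Set.mem_preimage, Set.mem_singleton_iff, Set.mem_ofPred_eq, extendSeq, funext_iff]
  constructor
  · intro h i hi
    simpa [hi] using h ⟨i, hi⟩
  · intro h i
    simpa using h i i.2

-- Plays the role of the tower property: both sides split into sums over histories of length `n` and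
-- next values, and `h.step` matches them term by term.
open Classical in
lemma StepChain.integral_step {μ : Measure Ω} [IsFiniteMeasure μ] {q : ℕ → (ℕ → A) → A → ℝ}
    (h : StepChain μ g q) {n : ℕ} {F : (ℕ → A) → A → E}
    (hF : ∀ a, DependsOn (fun s => F s a) (Set.Iio n)) :
    ∫ ω, F (fun k => g k ω) (g n ω) ∂μ =
      ∫ ω, ∑ a, q n (fun k => g k ω) a • F (fun k => g k ω) a ∂μ := by
  have hdep : ∀ a, DependsOn (fun s => q n s a • F s a) (Set.Iio n) := fun a x y hxy => by
    have h1 := hF a hxy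
    have h2 := h.dependsOn n a hxy
    simp only at h1 h2 ⊢
    rw [h1, h2]
  rw [integral_finsetSum _ fun a _ => (hdep a).integrable h.measurable_step μ]
  have hsum : ∀ ω, F (fun k => g k ω) (g n ω) =
      ∑ a, Set.indicator {ω | g n ω = a} (fun ω => F (fun k => g k ω) a) ω := by
    intro ω
    simp [Set.indicator_apply]
  simp_rw [hsum]
  rw [integral_finsetSum _ fun a _ =>
    ((hF a).integrable h.measurable_step μ).indicator (h.measurable_step n a)]
  refine Finset.sum_congr rfl fun a _ => ?_
  rw [integral_indicator (h.measurable_step n a),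
    (hF a).integral_eq_sum h.measurable_step,
    (hdep a).integral_eq_sum h.measurable_step]
  refine Finset.sum_congr rfl fun x _ => ?_
  rw [measureReal_restrict_apply' (h.measurable_step n a), smul_smul, ← h.step]
  rfl

end Integral

/-! ### Almost sure convergence from second moments -/

open Topology in
lemma ae_tendsto_zero_of_summable_integral_sq {Ω : Type*} [MeasurableSpace Ω] {μ : Measure Ω}
    {u : ℕ → Ω → ℝ} (hint : ∀ n, Integrable (fun ω => u n ω ^ 2) μ)
    (hsum : Summable fun n => ∫ ω, u n ω ^ 2 ∂μ) :
    ∀ᵐ ω ∂μ, Tendsto (fun n => u n ω) atTop (𝓝 0) := by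
  have hfin : ∫⁻ ω, ∑' n, ENNReal.ofReal (u n ω ^ 2) ∂μ ≠ ⊤ := by
    rw [lintegral_tsum fun n => (hint n).aemeasurable.ennreal_ofReal]
    simp_rw [← ofReal_integral_eq_lintegral_ofReal (hint _) (.of_forall fun ω => sq_nonneg _)]
    exact hsum.tsum_ofReal_ne_top
  filter_upwards [ae_lt_top' (AEMeasurable.tsum fun n =>
    (hint n).aemeasurable.ennreal_ofReal) hfin] with ω hω
  have h := ENNReal.tendsto_atTop_zero_of_tsum_ne_top hω.ne
  have h2 : Tendsto (fun n => u n ω ^ 2) atTop (𝓝 0) := by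
    have := (ENNReal.tendsto_toReal ENNReal.zero_ne_top).comp h
    simpa [Function.comp_def, ENNReal.toReal_ofReal (sq_nonneg _)] using this
  have h3 := (Real.continuous_sqrt.tendsto 0).comp h2
  rw [Real.sqrt_zero] at h3
  refine (tendsto_zero_iff_abs_tendsto_zero _).2 ?_
  simpa [Function.comp_def, Real.sqrt_sq_eq_abs] using h3

lemma summable_floor_pow_rpow {c r : ℝ} (hc : 1 < c) (hr : r < 0) :
    Summable fun j : ℕ => ((⌊c ^ j⌋₊ : ℕ) : ℝ) ^ r := by
  have hc0 : 0 < c := by linarith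
  have h1 : Summable fun j : ℕ => (2 : ℝ) ^ (-r) * (c ^ r) ^ j :=
    (summable_geometric_of_lt_one (Real.rpow_nonneg hc0.le _)
      (Real.rpow_lt_one_of_one_lt_of_neg hc hr)).mul_left _
  refine .of_nonneg_of_le (fun j => by positivity) (fun j => ?_) h1
  have hcj : 1 ≤ c ^ j := one_le_pow₀ hc.le
  have hfl : (1 : ℝ) ≤ ⌊c ^ j⌋₊ := by exact_mod_cast (Nat.one_le_floor_iff _).2 hcj
  have hlt := Nat.lt_floor_add_one (c ^ j)
  -- For $x\ge1$ one has $\lfloor x\rfloor\ge x/2$; since `r` is negative, this costs only the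
  -- factor $2^{-r}$.
  calc ((⌊c ^ j⌋₊ : ℕ) : ℝ) ^ r ≤ (c ^ j / 2) ^ r :=
        Real.rpow_le_rpow_of_nonpos (by positivity) (by linarith) hr.le
    _ = (2 : ℝ) ^ (-r) * (c ^ r) ^ j := by
        rw [Real.div_rpow (by positivity) (by norm_num), Real.rpow_neg (by norm_num),
          ← Real.rpow_natCast, ← Real.rpow_natCast, ← Real.rpow_mul hc0.le, ← Real.rpow_mul hc0.le,
          mul_comm (j : ℝ) r]
        field_simp

-- Along $\lfloor b^n\rfloor$ the second moments of $u_n/n$ are summable because `s < 2`, which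
-- gives convergence there. The one-sided increment bound makes $u_n+cn$ monotone, and monotonicity
-- fills the gaps as $b\downarrow1$.
open Topology in
lemma ae_tendsto_div_zero_of_integral_sq_le {Ω : Type*} [MeasurableSpace Ω] {μ : Measure Ω}
    {u : ℕ → Ω → ℝ} {c C s : ℝ} (hs : s < 2) (hinc : ∀ n ω, -c ≤ u (n + 1) ω - u n ω)
    (hint : ∀ n, Integrable (fun ω => u n ω ^ 2) μ)
    (hmom : ∀ n, 1 ≤ n → ∫ ω, u n ω ^ 2 ∂μ ≤ C * (n : ℝ) ^ s) :
    ∀ᵐ ω ∂μ, Tendsto (fun n => u n ω / n) atTop (𝓝 0) := by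
  set b : ℕ → ℝ := fun k => 1 + 1 / ((k : ℝ) + 1) with hb
  have hb1 : ∀ k, 1 < b k := fun k => by
    have : (0 : ℝ) < 1 / ((k : ℝ) + 1) := by positivity
    simp only [hb]; linarith
  have hblim : Tendsto b atTop (𝓝 1) := by
    simpa [hb] using tendsto_one_div_add_atTop_nhds_zero_nat.const_add (1 : ℝ)
  have hsub : ∀ k, ∀ᵐ ω ∂μ,
      Tendsto (fun n : ℕ => u ⌊b k ^ n⌋₊ ω / (⌊b k ^ n⌋₊ : ℕ)) atTop (𝓝 0) := by
    intro k
    refine ae_tendsto_zero_of_summable_integral_sq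
      (u := fun n ω => u ⌊b k ^ n⌋₊ ω / (⌊b k ^ n⌋₊ : ℕ)) (fun n => ?_) ?_
    · simp_rw [div_pow]
      exact (hint _).div_const _
    · refine .of_nonneg_of_le (fun n => integral_nonneg fun ω => sq_nonneg _) (fun n => ?_)
        ((summable_floor_pow_rpow (hb1 k) (sub_neg.2 hs)).mul_left C)
      have hfl : 1 ≤ ⌊b k ^ n⌋₊ := (Nat.one_le_floor_iff _).2 (one_le_pow₀ (hb1 k).le)
      have hpos : (0 : ℝ) < (⌊b k ^ n⌋₊ : ℕ) := by exact_mod_cast hfl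
      simp_rw [div_pow]
      rw [integral_div, Real.rpow_sub hpos, Real.rpow_two, ← mul_div_assoc]
      gcongr
      exact hmom _ hfl
  filter_upwards [ae_all_iff.2 hsub] with ω hω
  have hmono : Monotone fun n => u n ω + c * n := monotone_nat_of_le_succ fun n => by
    have := hinc n ω
    push_cast
    linarith
  have heq : ∀ n : ℕ, n ≠ 0 → (u n ω + c * n) / n = u n ω / n + c := fun n hn => by
    have : (n : ℝ) ≠ 0 := by exact_mod_cast hn
    field_simp
  have hlim := tendsto_div_of_monotone_of_tendsto_div_floor_pow _ c hmono b hb1 hblim fun k => by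
    have h := (hω k).add_const c
    rw [zero_add] at h
    refine h.congr fun n => (heq _ ?_).symm
    have := (Nat.one_le_floor_iff (b k ^ n)).2 (one_le_pow₀ (hb1 k).le)
    omega
  have h := hlim.sub_const c
  rw [sub_self] at h
  refine h.congr' ?_
  filter_upwards [eventually_ne_atTop 0] with n hn
  rw [heq n hn]
  ring

/-! ### Geometry of the tree and the decreasing step -/

/-- Each such neighbour is the second vertex of a geodesic from `w` to `r`. Geodesics are paths, and
a tree has only one path between two vertices. -/
lemma _root_.SimpleGraph.IsTree.eq_of_adj_of_dist_add_one {V : Type*} {G : SimpleGraph V}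
    (hG : G.IsTree) {r w x y : V} (hx : G.Adj w x) (hy : G.Adj w y)
    (hdx : G.dist x r + 1 = G.dist w r) (hdy : G.dist y r + 1 = G.dist w r) : x = y := by
  have key : ∀ z, G.Adj w z → G.dist z r + 1 = G.dist w r →
      ∃ p : G.Walk w r, p.IsPath ∧ p.snd = z := by
    intro z hz hd
    obtain ⟨p, hp⟩ := hG.connected.exists_walk_length_eq_dist z r
    refine ⟨.cons hz p, SimpleGraph.Walk.isPath_of_length_eq_dist _ ?_, by simp⟩
    simp [hp, hd]
  obtain ⟨p, hp, hpx⟩ := key x hx hdx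
  obtain ⟨q, hq, hqy⟩ := key y hy hdy
  rw [← hpx, ← hqy, (hG.existsUnique_path w r).unique hp hq]

section Tree

variable {Γ : Type*} [Group Γ] {S : Finset Γ} {d : ℕ}

/-- The identity would contribute no edge, leaving at most $d-1$ neighbours for each vertex. -/
lemma one_notMem (hcard : S.card = d) (hsymm : ∀ s ∈ S, s⁻¹ ∈ S)
    (htree : IsRegularTree (leftCayley (S : Set Γ)) d) : (1 : Γ) ∉ S := by
  intro h1
  have h := htree.degree_eq 1
  have hsub : (leftCayley (S : Set Γ)).neighborSet 1 ⊆ (S : Set Γ) \ {1} := by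
    intro y hy
    simp only [SimpleGraph.mem_neighborSet, leftCayley, SimpleGraph.fromRel_adj, inv_one, mul_one,
      one_mul, Finset.mem_coe] at hy
    refine ⟨?_, fun h => hy.1 h.symm⟩
    rcases hy.2 with h | h
    · exact h
    · simpa using hsymm _ h
  have h2 := Set.ncard_le_ncard hsub (S.finite_toSet.subset Set.sdiff_subset)
  rw [h, Set.ncard_sdiff_singleton_of_mem (by simpa using h1), Set.ncard_coe_finset, hcard] at h2
  have : 0 < S.card := Finset.card_pos.2 ⟨1, h1⟩
  omega

lemma adj_mul (h1 : (1 : Γ) ∉ S) {a : Γ} (ha : a ∈ S) (w : Γ) :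
    (leftCayley (S : Set Γ)).Adj w (a * w) := by
  simp only [leftCayley, SimpleGraph.fromRel_adj, mul_inv_cancel_right, Finset.mem_coe]
  refine ⟨fun h => h1 ?_, .inl ha⟩
  have : a = 1 := by simpa using h.symm
  rwa [← this]

lemma exists_mem_of_adj (hsymm : ∀ s ∈ S, s⁻¹ ∈ S) {w y : Γ}
    (h : (leftCayley (S : Set Γ)).Adj w y) : ∃ a ∈ S, a * w = y := by
  simp only [leftCayley, SimpleGraph.fromRel_adj, Finset.mem_coe] at h
  refine ⟨y * w⁻¹, ?_, by group⟩
  rcases h.2 with h | h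
  · exact h
  · simpa using hsymm _ h

lemma exists_root_step (hsymm : ∀ s ∈ S, s⁻¹ ∈ S)
    (htree : IsRegularTree (leftCayley (S : Set Γ)) d) {w : Γ} (hw : w ≠ 1) :
    ∃ a ∈ S, wordDist S (a * w) 1 + 1 = wordDist S w 1 := by
  obtain ⟨p, hp⟩ := htree.isTree.connected.exists_walk_length_eq_dist w 1
  cases p with
  | nil => exact absurd rfl hw
  | @cons _ y _ h p =>
    obtain ⟨a, ha, rfl⟩ := exists_mem_of_adj hsymm h
    refine ⟨a, ha, ?_⟩
    have h1 := SimpleGraph.dist_le p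
    have h2 := htree.isTree.dist_eq_dist_add_one_of_adj 1 h
    simp only [SimpleGraph.Walk.length_cons] at hp
    rw [SimpleGraph.dist_comm, SimpleGraph.dist_comm (u := 1)] at h2
    unfold wordDist
    omega

lemma rootStep_spec (hsymm : ∀ s ∈ S, s⁻¹ ∈ S)
    (htree : IsRegularTree (leftCayley (S : Set Γ)) d) {w : Γ} (hw : w ≠ 1) :
    rootStep S w ∈ S ∧ wordDist S (rootStep S w * w) 1 + 1 = wordDist S w 1 := by
  have h := exists_root_step hsymm htree hw
  rw [rootStep, dif_pos h]
  exact h.choose_spec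

-- In a tree the distances of adjacent vertices to the root differ by exactly one, so a step that
-- does not decrease the distance increases it; uniqueness of the decreasing neighbour identifies
-- the step.
open Classical in
lemma wordDist_mul (h1 : (1 : Γ) ∉ S) (hsymm : ∀ s ∈ S, s⁻¹ ∈ S)
    (htree : IsRegularTree (leftCayley (S : Set Γ)) d) {a : Γ} (ha : a ∈ S) (w : Γ) :
    (wordDist S (a * w) 1 : ℝ) =
      wordDist S w 1 + if w ≠ 1 ∧ a = rootStep S w then (-1 : ℝ) else 1 := by
  have hadj := htree.isTree.dist_eq_dist_add_one_of_adj 1 (adj_mul h1 ha w)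
  rw [SimpleGraph.dist_comm, SimpleGraph.dist_comm (u := 1)] at hadj
  change wordDist S w 1 = wordDist S (a * w) 1 + 1 ∨
    wordDist S (a * w) 1 = wordDist S w 1 + 1 at hadj
  split_ifs with h
  · obtain ⟨hw, rfl⟩ := h
    rw [← (rootStep_spec hsymm htree hw).2]
    push_cast
    ring
  · rcases hadj with hd | hd
    · exfalso
      have hw : w ≠ 1 := by
        rintro rfl
        simp [wordDist] at hd
      refine h ⟨hw, ?_⟩
      obtain ⟨hr, hrd⟩ := rootStep_spec hsymm htree hw
      exact mul_right_cancel (htree.isTree.eq_of_adj_of_dist_add_one (adj_mul h1 ha w)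
        (adj_mul h1 hr w) hd.symm hrd)
    · rw [hd]
      push_cast
      ring

lemma distRoot_eq_zero (htree : IsRegularTree (leftCayley (S : Set Γ)) d) (s : ℕ → S) (n : ℕ) :
    distRoot s n = 0 ↔ position s n = 1 :=
  htree.isTree.connected.dist_eq_zero_iff

lemma dependsOn_position (n : ℕ) :
    DependsOn (fun s : ℕ → S => position s n) (Set.Iio n) := by
  induction n with
  | zero => intro s t _; rfl
  | succ n ih =>
    intro s t h
    have h1 := ih (x := s) (y := t) fun i hi => h i (Set.mem_Iio.2 (Nat.lt_succ_of_lt hi))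
    have h2 := h n (Set.mem_Iio.2 n.lt_succ_self)
    simp only [position] at h1 ⊢
    rw [h1, h2]

omit [Group Γ] in
lemma dependsOn_stepCount (n : ℕ) (a : Γ) :
    DependsOn (fun s : ℕ → S => stepCount s n a) (Set.Iio n) := by
  intro s t h
  simp only [stepCount]
  congr 1
  ext k
  simp only [Set.mem_ofPred_eq]
  refine and_congr_right fun hk => ?_
  rw [h k hk]

omit [Group Γ] in
open Classical in
lemma stepCount_eq_sum (s : ℕ → S) (n : ℕ) (a : Γ) :
    (stepCount s n a : ℝ) = ∑ k ∈ Finset.range n, if (s k : Γ) = a then (1 : ℝ) else 0 := by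
  rw [Finset.sum_boole, stepCount, ← Set.ncard_coe_finset]
  congr 2
  ext k
  simp

end Tree

/-! ### Martingales with bounded increments and their exponentials -/

/-- The one-step estimate behind the central limit theorem. The mean-zero condition kills the linear
Taylor term, and $e^{V/2}$ compensates the quadratic one, leaving a third-order error. -/
lemma norm_exp_mul_sum_exp_sub_one_le {A : Type*} [Fintype A] {q y : A → ℝ} {δ : ℝ}
    (hq : ∀ a, 0 ≤ q a) (hq1 : ∑ a, q a = 1) (hy : ∀ a, |y a| ≤ δ) (hy0 : ∑ a, q a * y a = 0)
    (hδ1 : δ ≤ 1) :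
    ‖Complex.exp ((∑ a, q a * y a ^ 2 : ℝ) / 2) * ∑ a, (q a : ℂ) * Complex.exp (y a * Complex.I)
      - 1‖ ≤ 6 * δ ^ 3 := by
  -- A negative `δ` would force `A` to be empty, against total mass 1.
  have hδ0 : 0 ≤ δ := by
    by_contra! hδ
    have : ∀ a : A, False := fun a => by linarith [abs_nonneg (y a), hy a]
    have : IsEmpty A := ⟨this⟩
    simp at hq1
  set V := ∑ a, q a * y a ^ 2 with hV
  have hV0 : 0 ≤ V := Finset.sum_nonneg fun a _ => mul_nonneg (hq a) (sq_nonneg _)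
  have hVδ : V ≤ δ ^ 2 := by
    calc V ≤ ∑ a, q a * δ ^ 2 := Finset.sum_le_sum fun a _ =>
          mul_le_mul_of_nonneg_left (sq_le_sq' (by linarith [neg_abs_le (y a), hy a])
            ((le_abs_self _).trans (hy a))) (hq a)
      _ = δ ^ 2 := by rw [← Finset.sum_mul, hq1, one_mul]
  have hδ2 : δ ^ 2 ≤ 1 := pow_le_one₀ hδ0 hδ1
  have hr : ‖∑ a, (q a : ℂ) * Complex.exp (y a * Complex.I) - (1 - V / 2 : ℝ)‖ ≤ δ ^ 3 := by
    have hmain : ∑ a, (q a : ℂ) * Complex.exp (y a * Complex.I) - (1 - V / 2 : ℝ) =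
        ∑ a, (q a : ℂ) * (Complex.exp (y a * Complex.I) -
          ∑ m ∈ Finset.range 3, (y a * Complex.I) ^ m / (m.factorial : ℂ)) := by
      have h1 : ∑ a, (q a : ℂ) * ∑ m ∈ Finset.range 3, (y a * Complex.I) ^ m / (m.factorial : ℂ) =
          (1 - V / 2 : ℝ) := by
        have h2 : ∀ a, (q a : ℂ) * ∑ m ∈ Finset.range 3, (y a * Complex.I) ^ m / (m.factorial : ℂ) =
            (q a : ℂ) + ((q a * y a : ℝ) : ℂ) * Complex.I - ((q a * y a ^ 2 : ℝ) : ℂ) / 2 := by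
          intro a
          simp only [Finset.sum_range_succ, Finset.sum_range_zero, Nat.factorial, mul_pow,
            Complex.I_sq]
          push_cast
          ring
        simp_rw [h2]
        rw [Finset.sum_sub_distrib, Finset.sum_add_distrib, ← Finset.sum_mul, ← Finset.sum_div,
          ← Complex.ofReal_sum, ← Complex.ofReal_sum, ← Complex.ofReal_sum, hq1, hy0, ← hV]
        push_cast
        ring
      rw [← h1, ← Finset.sum_sub_distrib]
      exact Finset.sum_congr rfl fun a _ => by ring
    rw [hmain]
    calc _ ≤ ∑ a, q a * δ ^ 3 := by
          refine norm_sum_le_of_le _ fun a _ => ?_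
          rw [norm_mul, Complex.norm_real, Real.norm_of_nonneg (hq a)]
          refine mul_le_mul_of_nonneg_left ?_ (hq a)
          have hn : ‖(y a : ℂ) * Complex.I‖ = |y a| := by simp
          refine (Complex.exp_bound (hn ▸ (hy a).trans hδ1) (by norm_num)).trans ?_
          rw [hn]
          have h3 : |y a| ^ 3 ≤ δ ^ 3 := pow_le_pow_left₀ (abs_nonneg _) (hy a) 3
          have h4 : 0 ≤ |y a| ^ 3 := by positivity
          norm_num [Nat.factorial]
          linarith
      _ = δ ^ 3 := by rw [← Finset.sum_mul, hq1, one_mul]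
  have hu : |Real.exp (-(V / 2)) - 1 - -(V / 2)| ≤ (-(V / 2)) ^ 2 :=
    Real.abs_exp_sub_one_sub_id_le (by rw [abs_neg, abs_of_nonneg (by positivity)]; linarith)
  -- Factoring out $e^{V/2}$ leaves a difference of two Taylor remainders, of the characteristic
  -- function and of $e^{-V/2}$, both taken around $1-V/2$.
  have hsplit : Complex.exp ((V : ℝ) / 2) * ∑ a, (q a : ℂ) * Complex.exp (y a * Complex.I) - 1 =
      (Real.exp (V / 2) : ℂ) * ((∑ a, (q a : ℂ) * Complex.exp (y a * Complex.I) - (1 - V / 2 : ℝ)) -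
        ((Real.exp (-(V / 2)) - 1 - -(V / 2) : ℝ) : ℂ)) := by
    have : Complex.exp (V / 2) * Complex.exp (-(V / 2)) = 1 := by
      rw [← Complex.exp_add, add_neg_cancel, Complex.exp_zero]
    push_cast
    linear_combination this
  rw [hsplit, norm_mul, Complex.norm_real, Real.norm_of_nonneg (Real.exp_nonneg _)]
  have hexp : Real.exp (V / 2) ≤ 3 :=
    (Real.exp_le_exp.2 (by linarith : V / 2 ≤ 1)).trans Real.exp_one_lt_d9.le |>.trans (by norm_num)
  have hδ43 : (V / 2) ^ 2 ≤ δ ^ 3 := by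
    have : (V / 2) ^ 2 ≤ (δ ^ 2) ^ 2 := pow_le_pow_left₀ (by positivity) (by linarith) 2
    refine this.trans ?_
    rw [← pow_mul]
    exact pow_le_pow_of_le_one hδ0 hδ1 (by norm_num)
  have hin := norm_sub_le_of_le hr (a₂ := ((Real.exp (-(V / 2)) - 1 - -(V / 2) : ℝ) : ℂ))
    (r₂ := δ ^ 3) (by
      rw [Complex.norm_real]
      exact hu.trans (by rwa [neg_sq]))
  calc _ ≤ 3 * (δ ^ 3 + δ ^ 3) := by gcongr
    _ = 6 * δ ^ 3 := by ring

section Martingale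

variable {A : Type*}

/-- The sum of the first `n` increments `X k s (s k)`. -/
def martSum (X : ℕ → (ℕ → A) → A → ℝ) (n : ℕ) (s : ℕ → A) : ℝ :=
  ∑ k ∈ Finset.range n, X k s (s k)

/-- The conditional second moment of the `n`-th increment. -/
def condVar [Fintype A] (q X : ℕ → (ℕ → A) → A → ℝ) (n : ℕ) (s : ℕ → A) : ℝ :=
  ∑ a, q n s a * X n s a ^ 2

/-- The sum of the conditional second moments of the first `n` increments. -/
def condVarSum [Fintype A] (q X : ℕ → (ℕ → A) → A → ℝ) (n : ℕ) (s : ℕ → A) : ℝ :=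
  ∑ k ∈ Finset.range n, condVar q X k s

/-- `X` gives bounded martingale differences for the transition probabilities `q`. -/
structure IsMartDiff [Fintype A] (q X : ℕ → (ℕ → A) → A → ℝ) (B : ℝ) : Prop where
  dependsOn : ∀ n a, DependsOn (fun s => X n s a) (Set.Iio n)
  abs_le : ∀ n s a, |X n s a| ≤ B
  sum_eq_zero : ∀ n s, ∑ a, q n s a * X n s a = 0

lemma _root_.DependsOn.of_Iio_le {E : Type*} {m n : ℕ} {F : (ℕ → A) → E}
    (hF : DependsOn F (Set.Iio m)) (h : m ≤ n) : DependsOn F (Set.Iio n) :=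
  fun _ _ hxy => hF fun i hi => hxy i (lt_of_lt_of_le hi h)

variable [Fintype A] {q X : ℕ → (ℕ → A) → A → ℝ} {B : ℝ}

lemma IsMartDiff.dependsOn_martSum (hX : IsMartDiff q X B) (n : ℕ) :
    DependsOn (martSum X n) (Set.Iio n) := by
  intro x y hxy
  refine Finset.sum_congr rfl fun k hk => ?_
  have hk' := Finset.mem_range.1 hk
  rw [hxy k hk']
  exact (hX.dependsOn k (y k)).of_Iio_le hk'.le hxy

variable {Ω : Type*} [MeasurableSpace Ω] {μ : Measure Ω} {g : ℕ → Ω → A}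

lemma IsMartDiff.dependsOn_condVar (hX : IsMartDiff q X B) (h : StepChain μ g q) (n : ℕ) :
    DependsOn (condVar q X n) (Set.Iio n) := by
  intro x y hxy
  refine Finset.sum_congr rfl fun a _ => ?_
  have h1 := h.dependsOn n a hxy
  have h2 := hX.dependsOn n a hxy
  simp only at h1 h2
  rw [h1, h2]

lemma IsMartDiff.dependsOn_condVarSum (hX : IsMartDiff q X B) (h : StepChain μ g q) (n : ℕ) :
    DependsOn (condVarSum q X n) (Set.Iio n) := fun _ _ hxy =>
  Finset.sum_congr rfl fun k hk =>
    (hX.dependsOn_condVar h k).of_Iio_le (Finset.mem_range.1 hk).le hxy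

lemma IsMartDiff.condVar_le (hX : IsMartDiff q X B) (h : StepChain μ g q) (n : ℕ) (s : ℕ → A) :
    condVar q X n s ≤ B ^ 2 := by
  calc condVar q X n s ≤ ∑ a, q n s a * B ^ 2 := Finset.sum_le_sum fun a _ =>
        mul_le_mul_of_nonneg_left (sq_le_sq' (by linarith [neg_abs_le (X n s a), hX.abs_le n s a])
          ((le_abs_self _).trans (hX.abs_le n s a))) (h.nonneg n s a)
    _ = B ^ 2 := by rw [← Finset.sum_mul, h.sum_eq_one, one_mul]

lemma IsMartDiff.condVarSum_le (hX : IsMartDiff q X B) (h : StepChain μ g q) (n : ℕ)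
    (s : ℕ → A) : condVarSum q X n s ≤ n * B ^ 2 := by
  calc condVarSum q X n s ≤ ∑ k ∈ Finset.range n, B ^ 2 :=
        Finset.sum_le_sum fun _ _ => hX.condVar_le h _ _
    _ = n * B ^ 2 := by simp

variable [Nonempty A]

/-- Orthogonality of increments: the cross term averages to zero, so each step adds only the mean
conditional variance, at most $B^2$. -/
lemma IsMartDiff.integral_martSum_sq_le (hX : IsMartDiff q X B) (h : StepChain μ g q)
    [IsProbabilityMeasure μ] (n : ℕ) :
    ∫ ω, martSum X n (fun k => g k ω) ^ 2 ∂μ ≤ B ^ 2 * n := by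
  induction n with
  | zero => simp [martSum]
  | succ n ih =>
    have hdep : ∀ a, DependsOn (fun s => (martSum X n s + X n s a) ^ 2) (Set.Iio n) :=
      fun a x y hxy => by
        have h1 := hX.dependsOn_martSum n hxy
        have h2 := hX.dependsOn n a hxy
        simp only at h1 h2 ⊢
        rw [h1, h2]
    have hstep := h.integral_step (F := fun s a => (martSum X n s + X n s a) ^ 2) hdep
    have hdepM : DependsOn (fun s => martSum X n s ^ 2) (Set.Iio n) := fun x y hxy => by
      simp only
      rw [hX.dependsOn_martSum n hxy]
    have hexp : ∀ s, ∑ a, q n s a • (martSum X n s + X n s a) ^ 2 =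
        martSum X n s ^ 2 + condVar q X n s := by
      intro s
      have : ∀ a, q n s a • (martSum X n s + X n s a) ^ 2 = q n s a * martSum X n s ^ 2 +
          q n s a * X n s a * (2 * martSum X n s) + q n s a * X n s a ^ 2 := fun a => by
        rw [smul_eq_mul]; ring
      simp_rw [this]
      rw [Finset.sum_add_distrib, Finset.sum_add_distrib, ← Finset.sum_mul, ← Finset.sum_mul,
        h.sum_eq_one, hX.sum_eq_zero, condVar]
      ring
    simp_rw [hexp] at hstep
    simp_rw [martSum, Finset.sum_range_succ]
    simp_rw [martSum] at hstep ih hdepM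
    rw [hstep, integral_add (hdepM.integrable h.measurable_step μ)
      ((hX.dependsOn_condVar h n).integrable h.measurable_step μ)]
    have hV : ∫ ω, condVar q X n (fun k => g k ω) ∂μ ≤ B ^ 2 := by
      calc _ ≤ ∫ ω, B ^ 2 ∂μ := integral_mono
            ((hX.dependsOn_condVar h n).integrable h.measurable_step μ) (integrable_const _)
            fun ω => hX.condVar_le h n _
        _ = B ^ 2 := by simp
    push_cast
    linarith

open Topology in
lemma IsMartDiff.ae_tendsto_martSum_div (hX : IsMartDiff q X B) (h : StepChain μ g q)
    [IsProbabilityMeasure μ] :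
    ∀ᵐ ω ∂μ, Tendsto (fun n : ℕ => martSum X n (fun k => g k ω) / n) atTop (𝓝 0) := by
  refine ae_tendsto_div_zero_of_integral_sq_le (c := B) (C := B ^ 2) (s := 1) (by norm_num)
    (fun n ω => ?_) (fun n => ?_) fun n _ => ?_
  · rw [martSum, martSum, Finset.sum_range_succ, add_sub_cancel_left]
    linarith [neg_abs_le (X n (fun k => g k ω) (g n ω)), hX.abs_le n (fun k => g k ω) (g n ω)]
  · have hdepM : DependsOn (fun s => martSum X n s ^ 2) (Set.Iio n) := fun x y hxy => by
      simp only
      rw [hX.dependsOn_martSum n hxy]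
    exact hdepM.integrable h.measurable_step μ
  · simpa using hX.integral_martSum_sq_le h n

/-- The exponential `exp (i φ M_n + φ ^ 2 Q_n / 2)`, with `M_n` the martingale and `Q_n` the sum of
its conditional variances. -/
noncomputable def expMart (q X : ℕ → (ℕ → A) → A → ℝ) (φ : ℝ) (n : ℕ) (s : ℕ → A) : ℂ :=
  Complex.exp ((φ * martSum X n s : ℝ) * Complex.I) *
    Complex.exp ((φ ^ 2 * condVarSum q X n s : ℝ) / 2)

omit [Nonempty A] in
lemma IsMartDiff.dependsOn_expMart (hX : IsMartDiff q X B) (h : StepChain μ g q) (φ : ℝ) (n : ℕ) :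
    DependsOn (expMart q X φ n) (Set.Iio n) := fun x y hxy => by
  simp only [expMart]
  rw [hX.dependsOn_martSum n hxy, hX.dependsOn_condVarSum h n hxy]

-- The first factor has modulus one and $Q_n\le nB^2$ surely. For $\varphi=t/\sqrt n$ the bound no
-- longer depends on `n`.
omit [Nonempty A] in
lemma IsMartDiff.norm_expMart_le (hX : IsMartDiff q X B) (h : StepChain μ g q) (φ : ℝ) (n : ℕ)
    (s : ℕ → A) : ‖expMart q X φ n s‖ ≤ Real.exp ((|φ| * B) ^ 2 * n / 2) := by
  rw [expMart, norm_mul, Complex.norm_exp_ofReal_mul_I, one_mul, Complex.norm_exp]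
  refine Real.exp_le_exp.2 ?_
  have : (((φ ^ 2 * condVarSum q X n s : ℝ) : ℂ) / 2).re = φ ^ 2 * condVarSum q X n s / 2 := by
    rw [← Complex.ofReal_ofNat, ← Complex.ofReal_div, Complex.ofReal_re]
  rw [this, mul_pow, sq_abs]
  have := mul_le_mul_of_nonneg_left (hX.condVarSum_le h n s) (sq_nonneg φ)
  linarith

/-- Each step multiplies the exponential, in conditional mean, by $1+O((|\varphi|B)^3)$; the `n`
errors add up, each weighted by the sure bound on the exponential. -/
lemma IsMartDiff.norm_integral_expMart_sub_one_le (hX : IsMartDiff q X B) (h : StepChain μ g q)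
    [IsProbabilityMeasure μ] {φ : ℝ} (hφ : |φ| * B ≤ 1) (n : ℕ) :
    ‖∫ ω, expMart q X φ n (fun k => g k ω) ∂μ - 1‖ ≤
      n * (Real.exp ((|φ| * B) ^ 2 * n / 2) * (6 * (|φ| * B) ^ 3)) := by
  have hB : 0 ≤ B := (abs_nonneg _).trans (hX.abs_le 0 (fun _ => Classical.arbitrary A)
    (Classical.arbitrary A))
  induction n with
  | zero => simp [expMart, martSum, condVarSum]
  | succ n ih =>
    set F : (ℕ → A) → A → ℂ := fun s a => expMart q X φ n s *
      (Complex.exp ((φ ^ 2 * condVar q X n s : ℝ) / 2) *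
        Complex.exp ((φ * X n s a : ℝ) * Complex.I)) with hF
    have hsucc : ∀ s, expMart q X φ (n + 1) s = F s (s n) := by
      intro s
      simp only [hF, expMart, martSum, condVarSum, Finset.sum_range_succ, ← Complex.exp_add]
      congr 1
      push_cast
      ring
    have hdep : ∀ a, DependsOn (fun s => F s a) (Set.Iio n) := fun a x y hxy => by
      have h2 := hX.dependsOn n a hxy
      simp only [hF] at h2 ⊢
      rw [hX.dependsOn_expMart h φ n hxy, hX.dependsOn_condVar h n hxy, h2]
    simp_rw [hsucc]
    rw [h.integral_step hdep]
    -- The defect from the martingale property, in the form of the one-step estimate applied to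
    -- $y_a=\varphi X_n(a)$.
    set R : (ℕ → A) → ℂ := fun s => expMart q X φ n s *
      (Complex.exp ((∑ a, q n s a * (φ * X n s a) ^ 2 : ℝ) / 2) *
        ∑ a, (q n s a : ℂ) * Complex.exp ((φ * X n s a : ℝ) * Complex.I) - 1) with hR
    have hsplit : ∀ s, ∑ a, q n s a • F s a = expMart q X φ n s + R s := by
      intro s
      have hv : φ ^ 2 * condVar q X n s = ∑ a, q n s a * (φ * X n s a) ^ 2 := by
        rw [condVar, Finset.mul_sum]
        exact Finset.sum_congr rfl fun a _ => by ring
      simp only [hF, hR, hv]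
      rw [mul_sub, mul_one, add_sub_cancel, Finset.mul_sum, Finset.mul_sum]
      refine Finset.sum_congr rfl fun a _ => ?_
      rw [Complex.real_smul]
      ring
    have hZint := (hX.dependsOn_expMart h φ n).integrable h.measurable_step μ
    have hdepS : DependsOn (fun s => ∑ a, q n s a • F s a) (Set.Iio n) := fun x y hxy =>
      Finset.sum_congr rfl fun a _ => by
        have h1 := h.dependsOn n a hxy
        have h2 := hdep a hxy
        simp only at h1 h2
        rw [h1, h2]
    have hdepR : DependsOn R (Set.Iio n) := fun x y hxy => by
      have e : ∀ s, R s = (∑ a, q n s a • F s a) - expMart q X φ n s := fun s => by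
        rw [hsplit]; ring
      have h1 := hdepS hxy
      simp only at h1
      rw [e, e, h1, hX.dependsOn_expMart h φ n hxy]
    simp_rw [hsplit]
    rw [integral_add hZint (hdepR.integrable h.measurable_step μ), add_sub_right_comm]
    have hRle : ∀ s, ‖R s‖ ≤ Real.exp ((|φ| * B) ^ 2 * n / 2) * (6 * (|φ| * B) ^ 3) := by
      intro s
      rw [hR, norm_mul]
      refine mul_le_mul (hX.norm_expMart_le h φ n s) ?_ (norm_nonneg _) (Real.exp_nonneg _)
      refine norm_exp_mul_sum_exp_sub_one_le (h.nonneg n s) (h.sum_eq_one n s) (fun a => ?_) ?_ hφ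
      · rw [abs_mul]
        exact mul_le_mul_of_nonneg_left (hX.abs_le n s a) (abs_nonneg _)
      · simp_rw [mul_left_comm _ φ]
        rw [← Finset.mul_sum, hX.sum_eq_zero, mul_zero]
    have hR2 := norm_integral_le_of_norm_le_const (μ := μ) (.of_forall fun ω => hRle fun k => g k ω)
    rw [probReal_univ, mul_one] at hR2
    have hmono : Real.exp ((|φ| * B) ^ 2 * n / 2) * (6 * (|φ| * B) ^ 3) ≤
        Real.exp ((|φ| * B) ^ 2 * (n + 1 : ℕ) / 2) * (6 * (|φ| * B) ^ 3) := by
      gcongr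
      exact n.le_succ
    have hmono' := mul_le_mul_of_nonneg_left hmono n.cast_nonneg (α := ℝ)
    refine (norm_add_le_of_le ih hR2).trans ?_
    push_cast at hmono hmono' ⊢
    linarith

end Martingale

/-! ### The martingale central limit theorem -/

section CLT

variable {A : Type*} [Fintype A] [Nonempty A] {q X : ℕ → (ℕ → A) → A → ℝ} {B : ℝ}
  {Ω : Type*} [MeasurableSpace Ω] {μ : Measure Ω} [IsProbabilityMeasure μ] {g : ℕ → Ω → A}

open Topology in
lemma IsMartDiff.tendsto_integral_expMart (hX : IsMartDiff q X B) (h : StepChain μ g q) (t : ℝ) :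
    Tendsto (fun n : ℕ => ∫ ω, expMart q X (t / √n) n (fun k => g k ω) ∂μ) atTop (𝓝 1) := by
  have hB : 0 ≤ B := (abs_nonneg _).trans (hX.abs_le 0 (fun _ => Classical.arbitrary A)
    (Classical.arbitrary A))
  have hsqrt : Tendsto (fun n : ℕ => √(n : ℝ)) atTop atTop :=
    Real.tendsto_sqrt_atTop.comp tendsto_natCast_atTop_atTop
  rw [tendsto_iff_norm_sub_tendsto_zero]
  -- The accumulated error at $\varphi=t/\sqrt n$: `n` terms of order $n^{-3/2}$.
  have hlim : Tendsto (fun n : ℕ => Real.exp ((|t| * B) ^ 2 / 2) * (6 * (|t| * B) ^ 3) / √n)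
      atTop (𝓝 0) := hsqrt.const_div_atTop _
  refine squeeze_zero' (.of_forall fun _ => norm_nonneg _) ?_ hlim
  filter_upwards [hsqrt.eventually_ge_atTop (|t| * B), eventually_gt_atTop 0] with n hn hn0
  have hs : 0 < √(n : ℝ) := Real.sqrt_pos.2 (by exact_mod_cast hn0)
  have hss : √(n : ℝ) ^ 2 = n := Real.sq_sqrt n.cast_nonneg
  have habs : |t / √n| * B = |t| * B / √n := by
    rw [abs_div, abs_of_pos hs]
    ring
  refine (hX.norm_integral_expMart_sub_one_le h (φ := t / √n) ?_ n).trans_eq ?_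
  · rw [habs, div_le_one hs]
    exact hn
  · rw [habs, div_pow, div_pow, hss, div_mul_cancel₀ _ (by positivity : (n : ℝ) ≠ 0)]
    nth_rewrite 1 [← hss]
    field_simp

-- The expected exponential martingale tends to 1, so it remains to replace the random factor
-- $e^{t^2Q_n/(2n)}$ by its limit $e^{vt^2/2}$. The replacement error `D` is bounded and tends to
-- zero almost surely.
open Topology in
lemma IsMartDiff.tendsto_integral_exp_martSum (hX : IsMartDiff q X B) (h : StepChain μ g q)
    {v : ℝ} (hv : ∀ᵐ ω ∂μ, Tendsto (fun n : ℕ => condVarSum q X n (fun k => g k ω) / n)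
      atTop (𝓝 v)) (t : ℝ) :
    Tendsto (fun n : ℕ => ∫ ω, Complex.exp (t * (martSum X n (fun k => g k ω) / √n : ℝ) * Complex.I)
      ∂μ) atTop (𝓝 (Complex.exp (-(v * t ^ 2 / 2 : ℝ)))) := by
  set c : ℂ := Complex.exp (-(v * t ^ 2 / 2 : ℝ)) with hc
  have hEZ := (hX.tendsto_integral_expMart h t).const_mul c
  rw [mul_one] at hEZ
  set D : ℕ → (ℕ → A) → ℂ := fun n s =>
    Complex.exp (t * (martSum X n s / √n : ℝ) * Complex.I) *
      (1 - c * Complex.exp (((t / √n) ^ 2 * condVarSum q X n s : ℝ) / 2)) with hD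
  have hsplit : ∀ n s, Complex.exp (t * (martSum X n s / √n : ℝ) * Complex.I) =
      D n s + c * expMart q X (t / √n) n s := by
    intro n s
    have : (t : ℂ) * (martSum X n s / √n : ℝ) = (t / √n * martSum X n s : ℝ) := by
      push_cast
      ring
    simp only [hD, expMart, this]
    ring
  have hDdep : ∀ n, DependsOn (D n) (Set.Iio n) := fun n x y hxy => by
    simp only [hD]
    rw [hX.dependsOn_martSum n hxy, hX.dependsOn_condVarSum h n hxy]
  have hZint : ∀ n : ℕ, Integrable (fun ω => expMart q X (t / √n) n fun k => g k ω) μ := fun n =>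
    (hX.dependsOn_expMart h _ n).integrable h.measurable_step μ
  simp_rw [hsplit]
  have hadd : ∀ n : ℕ, ∫ ω, D n (fun k => g k ω) + c * expMart q X (t / √n) n (fun k => g k ω) ∂μ =
      (∫ ω, D n (fun k => g k ω) ∂μ) +
        c * ∫ ω, expMart q X (t / √n) n (fun k => g k ω) ∂μ := fun n => by
    rw [integral_add ((hDdep n).integrable h.measurable_step μ) ((hZint n).const_mul c),
      integral_const_mul]
  simp_rw [hadd]
  rw [show 𝓝 c = 𝓝 (0 + c) by rw [zero_add]]
  refine Tendsto.add ?_ hEZ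
  have hnorm : ∀ n s, ‖D n s‖ =
      ‖1 - c * Complex.exp (((t / √n) ^ 2 * condVarSum q X n s : ℝ) / 2)‖ := by
    intro n s
    simp only [hD]
    rw [norm_mul, ← Complex.ofReal_mul, Complex.norm_exp_ofReal_mul_I, one_mul]
  have hsq : ∀ (n : ℕ) s, (t / √n) ^ 2 * condVarSum q X n s = t ^ 2 * (condVarSum q X n s / n) := by
    intro n s
    rw [div_pow, Real.sq_sqrt n.cast_nonneg]
    ring
  rw [show (0 : ℂ) = ∫ _, 0 ∂μ by simp]
  refine tendsto_integral_of_dominated_convergence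
    (fun _ => 1 + ‖c‖ * Real.exp (t ^ 2 * B ^ 2 / 2))
    (fun n => ((hDdep n).stronglyMeasurable h.measurable_step).aestronglyMeasurable)
    (integrable_const _) (fun n => .of_forall fun ω => ?_) ?_
  · rw [hnorm]
    refine norm_sub_le_of_le (by simp) ?_
    rw [norm_mul, hsq, ← Complex.ofReal_ofNat, ← Complex.ofReal_div, Complex.norm_exp_ofReal,
      mul_div_assoc (t ^ 2) (B ^ 2), mul_div_assoc (t ^ 2)]
    gcongr
    rcases Nat.eq_zero_or_pos n with rfl | hn
    · simpa using sq_nonneg B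
    · rw [div_le_iff₀ (by exact_mod_cast hn), mul_comm]
      exact hX.condVarSum_le h n _
  · filter_upwards [hv] with ω hω
    rw [tendsto_zero_iff_norm_tendsto_zero]
    simp_rw [hnorm, hsq]
    have hlim : Tendsto (fun n : ℕ => t ^ 2 * (condVarSum q X n (fun k => g k ω) / n)) atTop
        (𝓝 (t ^ 2 * v)) := hω.const_mul _
    have hcont : Continuous fun x : ℝ => ‖1 - c * Complex.exp ((x : ℂ) / 2)‖ := by fun_prop
    have := (hcont.tendsto _).comp hlim
    rw [hc, ← Complex.exp_add] at this
    have h0 : (-(v * t ^ 2 / 2 : ℝ) : ℂ) + ((t ^ 2 * v : ℝ) : ℂ) / 2 = 0 := by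
      push_cast
      ring
    rw [h0, Complex.exp_zero, sub_self, norm_zero] at this
    exact this

open Topology in
/-- A central limit theorem for martingales with bounded increments. -/
theorem IsMartDiff.tendstoInDistribution (hX : IsMartDiff q X B) (h : StepChain μ g q)
    {v : ℝ} (hv0 : 0 ≤ v)
    (hv : ∀ᵐ ω ∂μ, Tendsto (fun n : ℕ => condVarSum q X n (fun k => g k ω) / n) atTop (𝓝 v)) :
    TendstoInDistribution (fun (n : ℕ) ω => martSum X n (fun k => g k ω) / √n) atTop
      (id : ℝ → ℝ) (fun _ => μ) (gaussianReal 0 v.toNNReal) where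
  forall_aemeasurable n :=
    (((hX.dependsOn_martSum n).stronglyMeasurable h.measurable_step).measurable.div_const
      _).aemeasurable
  tendsto := by
    refine ProbabilityMeasure.tendsto_iff_tendsto_charFun.2 fun t => ?_
    have hm : ∀ n : ℕ, AEMeasurable (fun ω => martSum X n (fun k => g k ω) / √n) μ := fun n =>
      (((hX.dependsOn_martSum n).stronglyMeasurable h.measurable_step).measurable.div_const
        _).aemeasurable
    simp only [ProbabilityMeasure.coe_mk, Measure.map_id, charFun_gaussianReal]
    simp_rw [charFun_apply_real]
    have hmap : ∀ n : ℕ, ∫ x : ℝ, Complex.exp (t * x * Complex.I)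
        ∂(μ.map fun ω => martSum X n (fun k => g k ω) / √n) =
        ∫ ω, Complex.exp (t * (martSum X n (fun k => g k ω) / √n : ℝ) * Complex.I) ∂μ := fun n =>
      integral_map (hm n) (by fun_prop)
    simp_rw [hmap]
    convert hX.tendsto_integral_exp_martSum h hv t using 3
    rw [Real.coe_toNNReal _ hv0]
    push_cast
    ring

end CLT

/-! ### Transition probabilities of the elephant random walk -/

section Steps

variable {Γ : Type*} {S : Finset Γ}

open Classical in
lemma stepCount_succ (s : ℕ → S) (n : ℕ) (a : Γ) :
    (stepCount s (n + 1) a : ℝ) = stepCount s n a + if (s n : Γ) = a then 1 else 0 := by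
  rw [stepCount_eq_sum, stepCount_eq_sum, Finset.sum_range_succ]

lemma stepCount_le (s : ℕ → S) (n : ℕ) (a : Γ) : (stepCount s n a : ℝ) ≤ n := by
  classical
  rw [stepCount_eq_sum, Finset.sum_boole]
  exact_mod_cast (Finset.card_filter_le _ _).trans_eq (Finset.card_range n)

lemma sum_stepCount (s : ℕ → S) (n : ℕ) : ∑ a : S, (stepCount s n a : ℝ) = n := by
  classical
  simp_rw [stepCount_eq_sum, SetLike.coe_eq_coe]
  rw [Finset.sum_comm]
  simp

/-- The probability that the elephant random walk makes an `a`-step after the steps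
`s 0, …, s (n - 1)`. -/
noncomputable def stepProb (S : Finset Γ) (p : ℝ) (n : ℕ) (s : ℕ → S) (a : S) : ℝ :=
  1 / (S.card : ℝ) + if n = 0 then 0 else
    (p * S.card - 1) / (S.card - 1) * (stepCount s n a / n - 1 / S.card)

/-- The form seen from the walk: the remembered step is `a` with probability $N_n(a)/n$. The
defining form instead isolates the deviation from $1/d$. -/
lemma stepProb_of_ne_zero {p : ℝ} (hS : 3 ≤ S.card) {n : ℕ} (hn : n ≠ 0) (s : ℕ → S) (a : S) :
    stepProb S p n s a = stepCount s n a / n * p +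
      (1 - stepCount s n a / n) * ((1 - p) / (S.card - 1)) := by
  have hd : (3 : ℝ) ≤ S.card := by exact_mod_cast hS
  have h0 : (S.card : ℝ) ≠ 0 := by linarith
  have h1 : (S.card : ℝ) - 1 ≠ 0 := by linarith
  rw [stepProb, if_neg hn]
  field_simp
  ring

lemma measurableSet_steps_eq {Ω : Type*} [MeasurableSpace Ω] {g : ℕ → Ω → S}
    (hg : ∀ n a, MeasurableSet {ω | g n ω = a}) (n : ℕ) (x : ℕ → S) :
    MeasurableSet {ω | ∀ i < n, g i ω = x i} := by
  have : {ω | ∀ i < n, g i ω = x i} = ⋂ i, ⋂ _ : i < n, {ω | g i ω = x i} := by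
    ext ω
    simp
  rw [this]
  exact .iInter fun i => .iInter fun _ => hg i _

/-- Eliminates the memory index: summing over its values, only the number of past `a`-steps matters.
-/
lemma IsElephantWalk.stepChain {p : ℝ} (hS : 3 ≤ S.card) (hp0 : 0 ≤ p) (hp1 : p < 1)
    {Ω : Type*} [MeasurableSpace Ω] {μ : Measure Ω} [IsProbabilityMeasure μ]
    {g : ℕ → Ω → S} {D : (n : ℕ) → Ω → Fin (n + 1)} (hg : IsElephantWalk S p μ g D) :
    StepChain μ g (stepProb S p) := by
  classical
  have hd : (3 : ℝ) ≤ S.card := by exact_mod_cast hS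
  have h0 : (S.card : ℝ) ≠ 0 := by linarith
  have h1 : (S.card : ℝ) - 1 ≠ 0 := by linarith
  refine ⟨hg.measurable_step, fun n a x y hxy => ?_, fun n s a => ?_, fun n s => ?_,
    fun n x a => ?_⟩
  · simp only [stepProb]
    rw [show stepCount x n (a : Γ) = stepCount y n a from dependsOn_stepCount n (a : Γ) hxy]
  · rcases eq_or_ne n 0 with rfl | hn
    · simp [stepProb]
    · rw [stepProb_of_ne_zero hS hn]
      have hn' : (0 : ℝ) < n := by exact_mod_cast Nat.pos_of_ne_zero hn
      have h2 : (stepCount s n a : ℝ) / n ≤ 1 := (div_le_one hn').2 (stepCount_le s n a)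
      have h3 : 0 ≤ (1 - p) / ((S.card : ℝ) - 1) := div_nonneg (by linarith) (by linarith)
      have h4 : 0 ≤ (stepCount s n a : ℝ) / n := by positivity
      exact add_nonneg (mul_nonneg h4 hp0) (mul_nonneg (by linarith) h3)
  · have hc : (Finset.univ : Finset S).card = S.card := by simp
    rcases eq_or_ne n 0 with rfl | hn
    · simp [stepProb, h0]
    · have hn' : (n : ℝ) ≠ 0 := by exact_mod_cast hn
      simp only [stepProb, if_neg hn]
      rw [Finset.sum_add_distrib, Finset.sum_const, ← Finset.mul_sum, Finset.sum_sub_distrib, ← Finset.sum_div,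
        sum_stepCount, Finset.sum_const, hc, div_self hn', nsmul_eq_mul, mul_one_div_cancel h0]
      ring
  · rcases n with _ | m
    · simpa [stepProb] using hg.first_step a
    · have hpre : ∀ ω, (∀ i < m + 1, g i ω = x i) ↔ ∀ i : Fin (m + 1), g i ω = x i := fun ω =>
        ⟨fun h i => h i i.2, fun h i hi => h ⟨i, hi⟩⟩
      have hun : {ω | (∀ i < m + 1, g i ω = x i) ∧ g (m + 1) ω = a} =
          ⋃ j ∈ (Finset.univ : Finset (Fin (m + 1))),
            {ω | (∀ i : Fin (m + 1), g i ω = x i) ∧ D m ω = j ∧ g (m + 1) ω = a} := by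
        ext ω
        simp only [Set.mem_ofPred_eq, hpre, Set.mem_iUnion, Finset.mem_univ, exists_prop, true_and]
        exact ⟨fun h => ⟨_, h.1, rfl, h.2⟩, fun ⟨_, h⟩ => ⟨h.1, h.2.2⟩⟩
      have hmeas : ∀ j : Fin (m + 1), MeasurableSet
          {ω | (∀ i : Fin (m + 1), g i ω = x i) ∧ D m ω = j ∧ g (m + 1) ω = a} := by
        intro j
        simp_rw [← hpre]
        exact (measurableSet_steps_eq hg.measurable_step (m + 1) x).inter
          ((hg.measurable_index m j).inter (hg.measurable_step (m + 1) a))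
      have hdisj : Set.PairwiseDisjoint ((Finset.univ : Finset (Fin (m + 1))) : Set (Fin (m + 1)))
          fun j => {ω | (∀ i : Fin (m + 1), g i ω = x i) ∧ D m ω = j ∧ g (m + 1) ω = a} := by
        intro j _ j' _ hjj
        refine Set.disjoint_left.2 fun ω h h' => hjj ?_
        rw [← h.2.1, ← h'.2.1]
      rw [hun, measureReal_biUnion_finset hdisj fun j _ => hmeas j]
      -- Both cases are written as a constant plus an indicator, so that summing over `j` produces
      -- `stepCount`.
      have hterm : ∀ j : Fin (m + 1),
          μ.real {ω | (∀ i : Fin (m + 1), g i ω = x i) ∧ D m ω = j ∧ g (m + 1) ω = a} =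
          μ.real {ω | ∀ i < m + 1, g i ω = x i} * (1 / ((m : ℝ) + 1)) *
            ((1 - p) / ((S.card : ℝ) - 1) +
              (if (x j : Γ) = a then 1 else 0) * (p - (1 - p) / ((S.card : ℝ) - 1))) := by
        intro j
        simp_rw [hpre]
        rw [← hg.index_uniform m (fun i => x i) j]
        split_ifs with h
        · have ha : a = x j := Subtype.ext h.symm
          rw [ha, hg.repeat_step m (fun i => x i) j]
          ring
        · rw [hg.other_step m (fun i => x i) j a fun h' => h (congrArg Subtype.val h').symm]
          ring
      simp_rw [hterm]
      rw [← Finset.mul_sum, Finset.sum_add_distrib, ← Finset.sum_mul, Finset.sum_const,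
        ← Finset.sum_range (fun j => if (x j : Γ) = a then (1 : ℝ) else 0), ← stepCount_eq_sum,
        stepProb_of_ne_zero hS m.succ_ne_zero, mul_assoc]
      congr 1
      have hm : (m : ℝ) + 1 ≠ 0 := by positivity
      simp only [Finset.card_univ, Fintype.card_fin, nsmul_eq_mul]
      push_cast
      field_simp
      ring

end Steps

/-! ### Almost sure convergence of the step frequencies -/

section Frequencies

variable {Γ : Type*} {S : Finset Γ} {p : ℝ} {Ω : Type*} [MeasurableSpace Ω] {μ : Measure Ω}
  [IsProbabilityMeasure μ] {g : ℕ → Ω → S}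

/-- The deviation of the number of `a`-steps from its mean. -/
noncomputable def centredCount (a : S) (n : ℕ) (s : ℕ → S) : ℝ :=
  stepCount s n a - n / S.card

lemma dependsOn_centredCount_sq (a : S) (n : ℕ) :
    DependsOn (fun s => centredCount a n s ^ 2) (Set.Iio n) := fun x y hxy => by
  simp only [centredCount]
  rw [show stepCount x n (a : Γ) = stepCount y n a from dependsOn_stepCount n (a : Γ) hxy]

/-- With $\kappa=\frac{pd-1}{d-1}$, the conditional mean of the next increment of the centred count
$Y_n$ is $\kappa Y_n/n$. Hence the cross term in the square is $2\kappa Y_n^2/n$, and the squared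
increment contributes at most 1. -/
lemma integral_centredCount_sq_succ_le (hS : 3 ≤ S.card) (h : StepChain μ g (stepProb S p))
    (a : S) {β : ℝ} (hβ : (p * S.card - 1) / (S.card - 1) ≤ β) (n : ℕ) :
    ∫ ω, centredCount a (n + 1) (fun k => g k ω) ^ 2 ∂μ ≤
      (1 + 2 * β / n) * ∫ ω, centredCount a n (fun k => g k ω) ^ 2 ∂μ + 1 := by
  classical
  have : Nonempty S := ⟨a⟩
  have hd : (3 : ℝ) ≤ S.card := by exact_mod_cast hS
  have h0 : (S.card : ℝ) ≠ 0 := by linarith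
  have hd1 : 0 ≤ 1 / (S.card : ℝ) := by positivity
  have hd2 : 1 / (S.card : ℝ) ≤ 1 := by
    rw [div_le_one (by linarith)]
    linarith
  set F : (ℕ → S) → S → ℝ := fun s b =>
    (centredCount a n s + ((if b = a then 1 else 0) - 1 / S.card)) ^ 2 with hF
  have hsucc : ∀ s, centredCount a (n + 1) s ^ 2 = F s (s n) := by
    intro s
    simp only [hF, centredCount]
    rw [stepCount_succ]
    simp only [SetLike.coe_eq_coe]
    push_cast
    ring
  have hdep : ∀ b, DependsOn (fun s => F s b) (Set.Iio n) := fun b x y hxy => by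
    simp only [hF, centredCount]
    rw [show stepCount x n (a : Γ) = stepCount y n a from dependsOn_stepCount n (a : Γ) hxy]
  have hle : ∀ s : ℕ → S, (∀ b, 0 ≤ stepProb S p n s b) → ∑ b, stepProb S p n s b = 1 →
      ∑ b, stepProb S p n s b • F s b ≤ (1 + 2 * β / n) * centredCount a n s ^ 2 + 1 := by
    intro s hq hq1
    set Y := centredCount a n s with hY
    have hmean : stepProb S p n s a - 1 / S.card =
        (p * S.card - 1) / (S.card - 1) * (Y / n) := by
      rcases eq_or_ne n 0 with rfl | hn
      · simp [stepProb]
      · have hn' : (n : ℝ) ≠ 0 := by exact_mod_cast hn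
        rw [stepProb, if_neg hn, hY, centredCount]
        field_simp
        ring
    have h1 : ∑ b, stepProb S p n s b • F s b = Y ^ 2 + 2 * Y * (stepProb S p n s a - 1 / S.card) +
        ∑ b, stepProb S p n s b * ((if b = a then 1 else 0) - 1 / (S.card : ℝ)) ^ 2 := by
      have h2 : ∀ b, stepProb S p n s b • F s b = stepProb S p n s b * (Y ^ 2 - 2 * Y / S.card) +
          (if b = a then stepProb S p n s b else 0) * (2 * Y) +
          stepProb S p n s b * ((if b = a then 1 else 0) - 1 / (S.card : ℝ)) ^ 2 := by
        intro b
        simp only [hF, smul_eq_mul]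
        split_ifs <;> ring
      simp_rw [h2]
      rw [Finset.sum_add_distrib, Finset.sum_add_distrib, ← Finset.sum_mul, ← Finset.sum_mul, hq1,
        Finset.sum_ite_eq' Finset.univ a, if_pos (Finset.mem_univ a)]
      ring
    have h3 : ∑ b, stepProb S p n s b * ((if b = a then 1 else 0) - 1 / (S.card : ℝ)) ^ 2 ≤ 1 := by
      refine (Finset.sum_le_sum fun b _ => mul_le_of_le_one_right (hq b) ?_).trans_eq hq1
      rw [sq_le_one_iff_abs_le_one, abs_le]
      split_ifs <;> constructor <;> linarith
    have h4 : (p * S.card - 1) / (S.card - 1) * (Y ^ 2 / n) ≤ β * (Y ^ 2 / n) :=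
      mul_le_mul_of_nonneg_right hβ (by positivity)
    rw [h1, hmean]
    calc _ = Y ^ 2 + 2 * ((p * S.card - 1) / (S.card - 1) * (Y ^ 2 / n)) +
          ∑ b, stepProb S p n s b * ((if b = a then 1 else 0) - 1 / (S.card : ℝ)) ^ 2 := by ring
      _ ≤ Y ^ 2 + 2 * (β * (Y ^ 2 / n)) + 1 := by gcongr
      _ = _ := by ring
  have hint := (dependsOn_centredCount_sq a n).integrable h.measurable_step μ
  simp_rw [hsucc]
  rw [h.integral_step hdep]
  calc _ ≤ ∫ ω, ((1 + 2 * β / n) * centredCount a n (fun k => g k ω) ^ 2 + 1) ∂μ := by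
        refine integral_mono (DependsOn.integrable (n := n)
          (F := fun s => ∑ b, stepProb S p n s b • F s b) (fun x y hxy => ?_) h.measurable_step μ)
          ((hint.const_mul _).add (integrable_const _)) fun ω => hle _ (h.nonneg n _)
            (h.sum_eq_one n _)
        refine Finset.sum_congr rfl fun b _ => ?_
        have e1 := h.dependsOn n b hxy
        have e2 := hdep b hxy
        simp only at e1 e2
        rw [e1, e2]
    _ = _ := by
        rw [integral_add (hint.const_mul _) (integrable_const _), integral_const_mul]
        simp

/-- $Kn^{1+\beta}$ is a supersolution: by Bernoulli it grows by a factor at least $1+(1+\beta)/n$,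
against $1+2\beta/n$ in the recurrence. The choice $K=1/(1-\beta)$ makes the surplus $n^\beta\ge1$,
which absorbs the added 1. Only an exponent below 2 is needed. -/
lemma le_mul_rpow_of_recurrence {y : ℕ → ℝ} {β : ℝ} (hβ0 : 0 ≤ β) (hβ1 : β < 1) (hy0 : y 0 = 0)
    (hy : ∀ n : ℕ, y (n + 1) ≤ (1 + 2 * β / n) * y n + 1) (n : ℕ) (hn : 1 ≤ n) :
    y n ≤ 1 / (1 - β) * (n : ℝ) ^ (1 + β) := by
  have hβ : 0 < 1 - β := by linarith
  induction n, hn using Nat.le_induction with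
  | base =>
    have h := hy 0
    simp only [hy0, mul_zero, zero_add] at h
    simp only [Nat.cast_one, Real.one_rpow, mul_one]
    refine h.trans ?_
    rw [le_div_iff₀ hβ]
    linarith
  | succ n hn ih =>
    have hn' : (1 : ℝ) ≤ n := by exact_mod_cast hn
    have hn0 : (0 : ℝ) < n := by linarith
    have hbern : 1 + (1 + β) * (1 / n : ℝ) ≤ (1 + 1 / n : ℝ) ^ (1 + β) :=
      one_add_mul_self_le_rpow_one_add
        ((by norm_num : (-1 : ℝ) ≤ 0).trans (by positivity)) (by linarith)
    have hsplit : ((n + 1 : ℕ) : ℝ) ^ (1 + β) = (n : ℝ) ^ (1 + β) * (1 + 1 / n : ℝ) ^ (1 + β) := by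
      rw [← Real.mul_rpow hn0.le (by positivity)]
      congr 1
      push_cast
      field_simp
    have hpow : (n : ℝ) ≤ (n : ℝ) ^ (1 + β) := by
      conv_lhs => rw [← Real.rpow_one (n : ℝ)]
      exact Real.rpow_le_rpow_of_exponent_le hn' (by linarith)
    set P := (n : ℝ) ^ (1 + β) with hP
    have hone : 1 ≤ P / n := (one_le_div hn0).2 hpow
    calc y (n + 1) ≤ (1 + 2 * β / n) * y n + 1 := hy n
      _ ≤ (1 + 2 * β / n) * (1 / (1 - β) * P) + P / n := by gcongr
      _ = 1 / (1 - β) * (P * (1 + (1 + β) * (1 / n : ℝ))) := by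
          field_simp
          ring
      _ ≤ 1 / (1 - β) * (P * (1 + 1 / n : ℝ) ^ (1 + β)) := by gcongr
      _ = _ := by rw [hsplit]

open Topology in
/-- The step frequencies of the elephant random walk converge almost surely. -/
lemma ae_tendsto_stepCount_div (hS : 3 ≤ S.card) (hp1 : p < 1)
    (h : StepChain μ g (stepProb S p)) :
    ∀ᵐ ω ∂μ, ∀ a : S, Tendsto (fun n : ℕ => (stepCount (fun k => g k ω) n a : ℝ) / n) atTop
      (𝓝 (1 / (S.card : ℝ))) := by
  refine ae_all_iff.2 fun a => ?_
  classical
  have : Nonempty S := ⟨a⟩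
  have hd : (3 : ℝ) ≤ S.card := by exact_mod_cast hS
  -- The growth bound needs a nonnegative exponent, while the ratio is negative for $p<1/d$; it is
  -- below 1 because $p<1$.
  set β := max ((p * S.card - 1) / ((S.card : ℝ) - 1)) 0 with hβ
  have hβ1 : β < 1 := by
    refine max_lt ?_ one_pos
    rw [div_lt_one (by linarith)]
    nlinarith
  have hd2 : 1 / (S.card : ℝ) ≤ 1 := by
    rw [div_le_one (by linarith)]
    linarith
  have hY : ∀ᵐ ω ∂μ, Tendsto (fun n : ℕ => centredCount a n (fun k => g k ω) / n) atTop (𝓝 0) := by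
    refine ae_tendsto_div_zero_of_integral_sq_le (c := 1) (C := 1 / (1 - β)) (s := 1 + β)
      (by linarith) (fun n ω => ?_)
      (fun n => (dependsOn_centredCount_sq a n).integrable h.measurable_step μ)
      (le_mul_rpow_of_recurrence (le_max_right _ _) hβ1 (by simp [centredCount, stepCount])
        (integral_centredCount_sq_succ_le hS h a (le_max_left _ _)))
    rw [centredCount, centredCount, stepCount_succ]
    push_cast
    rw [add_div]
    split_ifs <;> linarith
  filter_upwards [hY] with ω hω
  have h1 := hω.add_const (1 / (S.card : ℝ))
  rw [zero_add] at h1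
  refine h1.congr' ?_
  filter_upwards [eventually_ne_atTop 0] with n hn
  have hn' : (n : ℝ) ≠ 0 := by exact_mod_cast hn
  rw [centredCount]
  field_simp
  ring

end Frequencies

/-! ### Drift and martingale part of the distance; transience -/

section Distance

variable {Γ : Type*} [Group Γ] {S : Finset Γ}

open Classical in
/-- The change of the distance to the root by an `a`-step at `w`. -/
noncomputable def stepSign (S : Finset Γ) (w : Γ) (a : S) : ℝ :=
  if w ≠ 1 ∧ (a : Γ) = rootStep S w then -1 else 1

/-- The conditional mean of the change of the distance to the root. -/
noncomputable def drift (S : Finset Γ) (p : ℝ) (n : ℕ) (s : ℕ → S) : ℝ :=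
  ∑ a, stepProb S p n s a * stepSign S (position s n) a

/-- The centred change of the distance to the root. -/
noncomputable def distDiff (S : Finset Γ) (p : ℝ) (n : ℕ) (s : ℕ → S) (a : S) : ℝ :=
  stepSign S (position s n) a - drift S p n s

/-- The summand `ℓ_n / n - 1(Δ_n > 0) / d`. -/
noncomputable def freqDev (s : ℕ → S) (n : ℕ) : ℝ :=
  (ell s n : ℝ) / n - (if 0 < distRoot s n then (1 : ℝ) else 0) / S.card

open Classical in
/-- The number of visits to the root before time `n`. -/
noncomputable def visits (s : ℕ → S) (n : ℕ) : ℝ :=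
  ∑ k ∈ Finset.range n, if position s k = 1 then (1 : ℝ) else 0

lemma abs_stepSign (w : Γ) (a : S) : |stepSign S w a| = 1 := by
  unfold stepSign
  split_ifs <;> simp

omit [Group Γ] in
lemma dependsOn_stepProb (p : ℝ) (n : ℕ) (a : S) :
    DependsOn (fun s => stepProb S p n s a) (Set.Iio n) := fun x y hxy => by
  simp only [stepProb]
  rw [show stepCount x n (a : Γ) = stepCount y n a from dependsOn_stepCount n (a : Γ) hxy]

lemma dependsOn_drift (p : ℝ) (n : ℕ) : DependsOn (drift S p n) (Set.Iio n) := fun x y hxy => by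
  simp only [drift]
  rw [show position x n = position y n from dependsOn_position n hxy]
  refine Finset.sum_congr rfl fun a _ => ?_
  rw [show stepProb S p n x a = stepProb S p n y a from dependsOn_stepProb p n a hxy]

lemma dependsOn_visits (n : ℕ) : DependsOn (fun s : ℕ → S => visits s n) (Set.Iio n) :=
  fun x y hxy => Finset.sum_congr rfl fun k hk => by
    rw [show position x k = position y k from
      (dependsOn_position k).of_Iio_le (Finset.mem_range.1 hk).le hxy]

section Chain

variable {p : ℝ} {Ω : Type*} [MeasurableSpace Ω] {μ : Measure Ω} {g : ℕ → Ω → S}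

lemma StepChain.abs_drift_le (h : StepChain μ g (stepProb S p)) (n : ℕ) (s : ℕ → S) :
    |drift S p n s| ≤ 1 := by
  refine (Finset.abs_sum_le_sum_abs _ _).trans ?_
  simp_rw [abs_mul, abs_stepSign, mul_one, abs_of_nonneg (h.nonneg n s _)]
  exact (h.sum_eq_one n s).le

lemma StepChain.isMartDiff_distDiff (h : StepChain μ g (stepProb S p)) :
    IsMartDiff (stepProb S p) (distDiff S p) 2 where
  dependsOn n a x y hxy := by
    simp only [distDiff]
    rw [show position x n = position y n from dependsOn_position n hxy,
      dependsOn_drift p n hxy]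
  abs_le n s a := by
    have h1 := h.abs_drift_le n s
    have h2 := abs_stepSign (position s n) a
    have h3 := abs_sub (stepSign S (position s n) a) (drift S p n s)
    rw [distDiff]
    linarith
  sum_eq_zero n s := by
    simp_rw [distDiff, mul_sub]
    rw [Finset.sum_sub_distrib, ← Finset.sum_mul, h.sum_eq_one, one_mul, drift, sub_self]

/-- The variance of a $\pm1$ variable is determined by its mean, so the limit variance follows from
the limit drift. -/
lemma StepChain.condVar_distDiff (h : StepChain μ g (stepProb S p)) (n : ℕ) (s : ℕ → S) :
    condVar (stepProb S p) (distDiff S p) n s = 1 - drift S p n s ^ 2 := by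
  have h1 : ∀ a, stepProb S p n s a * distDiff S p n s a ^ 2 =
      stepProb S p n s a * (1 + drift S p n s ^ 2) -
        stepProb S p n s a * stepSign S (position s n) a * (2 * drift S p n s) := by
    intro a
    have h2 : stepSign S (position s n) a ^ 2 = 1 := by
      rw [← sq_abs, abs_stepSign, one_pow]
    rw [distDiff, sub_sq, h2]
    ring
  simp_rw [condVar, h1]
  rw [Finset.sum_sub_distrib, ← Finset.sum_mul, ← Finset.sum_mul, h.sum_eq_one, ← drift]
  ring

end Chain

/-- The Doob decomposition of the distance. -/
lemma distRoot_eq (hsymm : ∀ s ∈ S, s⁻¹ ∈ S)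
    (htree : IsRegularTree (leftCayley (S : Set Γ)) S.card) (p : ℝ) (s : ℕ → S) (n : ℕ) :
    (distRoot s n : ℝ) =
      martSum (distDiff S p) n s + ∑ k ∈ Finset.range n, drift S p k s := by
  rw [martSum, ← Finset.sum_add_distrib]
  simp_rw [distDiff, sub_add_cancel]
  induction n with
  | zero => simp [(distRoot_eq_zero htree s 0).2 rfl]
  | succ n ih =>
    rw [Finset.sum_range_succ, ← ih]
    exact wordDist_mul (one_notMem rfl hsymm htree) hsymm htree (s n).2 (position s n)

-- Away from the root the drift is $1-2P(\gamma_n)$. At the root it is $1=\frac{d-2}d+\frac2d$ and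
-- `freqDev` vanishes, whence the correction term.
open Classical in
lemma drift_eq {p : ℝ} (hS : 3 ≤ S.card) (hsymm : ∀ s ∈ S, s⁻¹ ∈ S)
    (htree : IsRegularTree (leftCayley (S : Set Γ)) S.card) {n : ℕ} {s : ℕ → S}
    (hq : ∑ a, stepProb S p n s a = 1) :
    drift S p n s = ((S.card : ℝ) - 2) / S.card +
      2 * (1 - p * S.card) / ((S.card : ℝ) - 1) * freqDev s n +
        2 / S.card * if position s n = 1 then (1 : ℝ) else 0 := by
  have hd : (3 : ℝ) ≤ S.card := by exact_mod_cast hS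
  have h0 : (S.card : ℝ) ≠ 0 := by linarith
  have h1 : (S.card : ℝ) - 1 ≠ 0 := by linarith
  by_cases hw : position s n = 1
  · have hz := (distRoot_eq_zero htree s n).2 hw
    simp only [drift, stepSign, freqDev, ell, hw, hz, ne_eq, not_true_eq_false, false_and, if_false,
      if_true, mul_one, hq, lt_irrefl, Nat.cast_zero, zero_div, sub_zero, mul_zero, add_zero]
    field_simp
    ring
  · have hn : n ≠ 0 := by
      rintro rfl
      exact hw rfl
    have hpos : 0 < distRoot s n :=
      Nat.pos_of_ne_zero fun h => hw ((distRoot_eq_zero htree s n).1 h)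
    set γ : S := ⟨rootStep S (position s n), (rootStep_spec hsymm htree hw).1⟩ with hγ
    have hsum : drift S p n s = 1 - 2 * stepProb S p n s γ := by
      have h2 : ∀ a, stepProb S p n s a * stepSign S (position s n) a =
          stepProb S p n s a - 2 * if a = γ then stepProb S p n s a else 0 := by
        intro a
        have h3 : a = γ ↔ (a : Γ) = rootStep S (position s n) := Subtype.ext_iff
        simp only [stepSign, hw, ne_eq, not_false_eq_true, true_and, h3]
        split_ifs <;> ring
      simp_rw [drift, h2]
      rw [Finset.sum_sub_distrib, hq, ← Finset.mul_sum, Finset.sum_ite_eq' Finset.univ γ,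
        if_pos (Finset.mem_univ γ)]
    rw [hsum, stepProb, if_neg hn, freqDev, ell, if_pos hw, if_pos hpos, if_neg hw]
    field_simp
    ring

/-- The direction $\gamma_n$ varies with `n`; summing over all of `S` bounds the deviation whichever
direction it is. -/
lemma abs_freqDev_le (hsymm : ∀ s ∈ S, s⁻¹ ∈ S)
    (htree : IsRegularTree (leftCayley (S : Set Γ)) S.card) (s : ℕ → S) (n : ℕ) :
    |freqDev s n| ≤ ∑ a : S, |(stepCount s n a : ℝ) / n - 1 / S.card| := by
  by_cases hw : position s n = 1
  · have hz := (distRoot_eq_zero htree s n).2 hw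
    simp only [freqDev, ell, hw, hz, ne_eq, not_true_eq_false, if_false, lt_irrefl, Nat.cast_zero,
      zero_div, sub_zero, abs_zero]
    exact Finset.sum_nonneg fun a _ => abs_nonneg _
  · have hpos : 0 < distRoot s n :=
      Nat.pos_of_ne_zero fun h => hw ((distRoot_eq_zero htree s n).1 h)
    rw [freqDev, ell, if_pos hw, if_pos hpos]
    have hγ := (rootStep_spec hsymm htree hw).1
    generalize rootStep S (position s n) = γ at hγ
    have key : ∀ f : S → ℝ, |f ⟨γ, hγ⟩| ≤ ∑ a, |f a| := fun f =>
      Finset.single_le_sum (f := fun a => |f a|) (fun a _ => abs_nonneg _)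
        (Finset.mem_univ (⟨γ, hγ⟩ : S))
    exact key fun a => (stepCount s n a : ℝ) / n - 1 / S.card

open Topology in
lemma tendsto_freqDev (hsymm : ∀ s ∈ S, s⁻¹ ∈ S)
    (htree : IsRegularTree (leftCayley (S : Set Γ)) S.card) {s : ℕ → S}
    (hs : ∀ a : S, Tendsto (fun n : ℕ => (stepCount s n a : ℝ) / n) atTop
      (𝓝 (1 / (S.card : ℝ)))) : Tendsto (freqDev s) atTop (𝓝 0) := by
  refine squeeze_zero_norm (abs_freqDev_le hsymm htree s) ?_
  have h : Tendsto (fun n : ℕ => ∑ a : S, |(stepCount s n a : ℝ) / n - 1 / S.card|) atTop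
      (𝓝 (∑ _ : S, 0)) := tendsto_finsetSum _ fun a _ => by
    have := ((hs a).sub_const (1 / (S.card : ℝ))).abs
    rwa [sub_self, abs_zero] at this
  simpa using h

lemma sum_drift_eq {p : ℝ} (hS : 3 ≤ S.card) (hsymm : ∀ s ∈ S, s⁻¹ ∈ S)
    (htree : IsRegularTree (leftCayley (S : Set Γ)) S.card) {s : ℕ → S}
    (hq : ∀ n, ∑ a, stepProb S p n s a = 1) (n : ℕ) :
    ∑ k ∈ Finset.range n, drift S p k s = n * (((S.card : ℝ) - 2) / S.card) +
      2 * (1 - p * S.card) / ((S.card : ℝ) - 1) * ∑ k ∈ Finset.range n, freqDev s k +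
        2 / S.card * visits s n := by
  simp_rw [drift_eq hS hsymm htree (hq _)]
  rw [Finset.sum_add_distrib, Finset.sum_add_distrib, Finset.sum_const, Finset.card_range,
    nsmul_eq_mul, ← Finset.mul_sum, ← Finset.mul_sum, visits]

lemma visits_nonneg (s : ℕ → S) (n : ℕ) : 0 ≤ visits s n :=
  Finset.sum_nonneg fun _ _ => by split_ifs <;> simp

lemma sqrt_mul_eq {p : ℝ} (hS : 3 ≤ S.card) (hsymm : ∀ s ∈ S, s⁻¹ ∈ S)
    (htree : IsRegularTree (leftCayley (S : Set Γ)) S.card) {s : ℕ → S}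
    (hq : ∀ n, ∑ a, stepProb S p n s a = 1) (n : ℕ) :
    √n * ((distRoot s n : ℝ) / n - ((S.card : ℝ) - 2) / S.card -
      2 * (1 - p * S.card) / ((S.card : ℝ) - 1) * Xi s n) =
      martSum (distDiff S p) n s / √n + 2 / S.card * (visits s n / √n) := by
  rcases Nat.eq_zero_or_pos n with rfl | hn
  · simp
  · have hn' : (0 : ℝ) < n := by exact_mod_cast hn
    have hs : √(n : ℝ) ≠ 0 := (Real.sqrt_pos.2 hn').ne'
    have hss : √(n : ℝ) ^ 2 = n := Real.sq_sqrt hn'.le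
    have hXi : Xi s n = 1 / n * ∑ k ∈ Finset.range n, freqDev s k := rfl
    have h1 : (distRoot s n : ℝ) / n - ((S.card : ℝ) - 2) / S.card -
        2 * (1 - p * S.card) / ((S.card : ℝ) - 1) * Xi s n =
        (martSum (distDiff S p) n s + 2 / S.card * visits s n) / n := by
      rw [distRoot_eq hsymm htree p, sum_drift_eq hS hsymm htree hq, hXi]
      generalize ∑ k ∈ Finset.range n, freqDev s k = θ
      generalize ((S.card : ℝ) - 2) / S.card = m
      generalize 2 * (1 - p * S.card) / ((S.card : ℝ) - 1) = c
      field_simp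
      ring
    rw [h1]
    generalize 2 / (S.card : ℝ) = c
    nth_rewrite 2 [← hss]
    field_simp

open Topology in
/-- The walk visits the root finitely often if the step frequencies converge. -/
lemma eventually_position_ne_one {p : ℝ} (hS : 3 ≤ S.card) (hsymm : ∀ s ∈ S, s⁻¹ ∈ S)
    (htree : IsRegularTree (leftCayley (S : Set Γ)) S.card) {s : ℕ → S}
    (hq : ∀ n, ∑ a, stepProb S p n s a = 1)
    (hM : Tendsto (fun n : ℕ => martSum (distDiff S p) n s / n) atTop (𝓝 0))
    (hθ : Tendsto (freqDev s) atTop (𝓝 0)) : ∀ᶠ n in atTop, position s n ≠ 1 := by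
  have hd : (3 : ℝ) ≤ S.card := by exact_mod_cast hS
  have hlim := (hM.add_const (((S.card : ℝ) - 2) / S.card)).add
    (hθ.cesaro.const_mul (2 * (1 - p * S.card) / ((S.card : ℝ) - 1)))
  have hpos : 0 < 0 + ((S.card : ℝ) - 2) / S.card +
      2 * (1 - p * S.card) / ((S.card : ℝ) - 1) * 0 := by
    rw [mul_zero, add_zero, zero_add]
    exact div_pos (by linarith) (by linarith)
  -- At a return, $0=\Delta_n$ equals `n` times an eventually positive quantity, with limit
  -- $\frac{d-2}d$, plus the nonnegative visit term: a contradiction.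
  filter_upwards [hlim.eventually_const_lt hpos, eventually_gt_atTop 0] with n hn hn0 hw
  have hn' : (0 : ℝ) < n := by exact_mod_cast hn0
  have hD := distRoot_eq hsymm htree p s n
  rw [(distRoot_eq_zero htree s n).2 hw, sum_drift_eq hS hsymm htree hq, Nat.cast_zero] at hD
  have hv : 0 ≤ 2 / (S.card : ℝ) * visits s n := mul_nonneg (by positivity) (visits_nonneg s n)
  have hmul := mul_pos hn' hn
  have heq : (n : ℝ) * (martSum (distDiff S p) n s / n + ((S.card : ℝ) - 2) / S.card +
      2 * (1 - p * S.card) / ((S.card : ℝ) - 1) * ((n : ℝ)⁻¹ * ∑ k ∈ Finset.range n, freqDev s k)) =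
      martSum (distDiff S p) n s + n * (((S.card : ℝ) - 2) / S.card) +
      2 * (1 - p * S.card) / ((S.card : ℝ) - 1) * ∑ k ∈ Finset.range n, freqDev s k := by
    generalize ((S.card : ℝ) - 2) / S.card = m
    generalize 2 * (1 - p * S.card) / ((S.card : ℝ) - 1) = c
    field_simp
  rw [heq] at hmul
  linarith

open Topology in
lemma tendsto_visits_div_sqrt {s : ℕ → S} (h : ∀ᶠ n in atTop, position s n ≠ 1) :
    Tendsto (fun n : ℕ => visits s n / √n) atTop (𝓝 0) := by
  obtain ⟨N, hN⟩ := eventually_atTop.1 h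
  have hle : ∀ n, visits s n ≤ N := by
    intro n
    classical
    rw [visits, Finset.sum_boole]
    have : (Finset.range n).filter (fun k => position s k = 1) ⊆ Finset.range N := by
      intro k hk
      rw [Finset.mem_filter] at hk
      by_contra hkN
      exact hN k (by simpa using hkN) hk.2
    exact_mod_cast (Finset.card_le_card this).trans_eq (Finset.card_range N)
  have hsqrt : Tendsto (fun n : ℕ => √(n : ℝ)) atTop atTop :=
    Real.tendsto_sqrt_atTop.comp tendsto_natCast_atTop_atTop
  refine squeeze_zero (fun n => div_nonneg (visits_nonneg s n) (Real.sqrt_nonneg _))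
    (fun n => div_le_div_of_nonneg_right (hle n) (Real.sqrt_nonneg _))
    (hsqrt.const_div_atTop (N : ℝ))

open Topology in
lemma tendsto_drift {p : ℝ} (hS : 3 ≤ S.card) (hsymm : ∀ s ∈ S, s⁻¹ ∈ S)
    (htree : IsRegularTree (leftCayley (S : Set Γ)) S.card) {s : ℕ → S}
    (hq : ∀ n, ∑ a, stepProb S p n s a = 1) (h : ∀ᶠ n in atTop, position s n ≠ 1)
    (hθ : Tendsto (freqDev s) atTop (𝓝 0)) :
    Tendsto (fun n => drift S p n s) atTop (𝓝 (((S.card : ℝ) - 2) / S.card)) := by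
  have hlim := (hθ.const_mul (2 * (1 - p * S.card) / ((S.card : ℝ) - 1))).const_add
    (((S.card : ℝ) - 2) / S.card)
  rw [mul_zero, add_zero] at hlim
  refine hlim.congr' ?_
  filter_upwards [h] with n hn
  rw [drift_eq hS hsymm htree (hq n), if_neg hn, mul_zero, add_zero]

end Distance

end ElephantWalk

/-! ### Assembly of the limit theorem -/

theorem theorem4 {Γ : Type*} [Group Γ] (S : Finset Γ) (d : ℕ) (hd : 3 ≤ d)
    (hcard : S.card = d) (hsymm : ∀ s ∈ S, s⁻¹ ∈ S)
    (htree : ElephantWalk.IsRegularTree (ElephantWalk.leftCayley (S : Set Γ)) d)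
    (p : ℝ) (hp0 : 0 ≤ p) (hp1 : p < 1)
    {Ω : Type*} [MeasurableSpace Ω] (μ : Measure Ω) [IsProbabilityMeasure μ]
    (g : ℕ → Ω → S) (D : (n : ℕ) → Ω → Fin (n + 1))
    (hg : ElephantWalk.IsElephantWalk S p μ g D) :
    TendstoInDistribution
      (fun (n : ℕ) (ω : Ω) =>
        Real.sqrt (n : ℝ) *
          ((ElephantWalk.distRoot (fun k => g k ω) n : ℝ) / (n : ℝ)
            - ((d : ℝ) - 2) / (d : ℝ)
            - 2 * (1 - p * (d : ℝ)) / ((d : ℝ) - 1) *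
                ElephantWalk.Xi (fun k => g k ω) n))
      atTop (id : ℝ → ℝ) (fun _ => μ)
      (gaussianReal 0 (4 * ((d : ℝ) - 1) / (d : ℝ) ^ 2).toNNReal) := by
  subst hcard
  have hdR : (3 : ℝ) ≤ S.card := by exact_mod_cast hd
  have : Nonempty S := (Finset.card_pos.1 (by omega)).to_subtype
  have h := hg.stepChain hd hp0 hp1
  have hX := h.isMartDiff_distDiff
  simp_rw [fun (n : ℕ) ω => ElephantWalk.sqrt_mul_eq (p := p) hd hsymm htree
    (s := fun k => g k ω) (fun n => h.sum_eq_one n _) n]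
  have hae : ∀ᵐ ω ∂μ, (∀ᶠ n in atTop, ElephantWalk.position (fun k => g k ω) n ≠ 1) ∧
      Tendsto (ElephantWalk.freqDev fun k => g k ω) atTop (nhds 0) := by
    filter_upwards [ElephantWalk.ae_tendsto_stepCount_div hd hp1 h,
      hX.ae_tendsto_martSum_div h] with ω hω hM
    have hθ := ElephantWalk.tendsto_freqDev hsymm htree hω
    exact ⟨ElephantWalk.eventually_position_ne_one hd hsymm htree (fun n => h.sum_eq_one n _)
      hM hθ, hθ⟩
  have hCLT := hX.tendstoInDistribution h (v := 4 * ((S.card : ℝ) - 1) / (S.card : ℝ) ^ 2)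
    (div_nonneg (by linarith) (sq_nonneg _)) (by
      filter_upwards [hae] with ω hω
      have hlim := ((ElephantWalk.tendsto_drift (p := p) hd hsymm htree
        (fun n => h.sum_eq_one n _) hω.1 hω.2).pow 2).const_sub 1
      have hv : 1 - (((S.card : ℝ) - 2) / S.card) ^ 2 =
          4 * ((S.card : ℝ) - 1) / (S.card : ℝ) ^ 2 := by
        have : (S.card : ℝ) ≠ 0 := by linarith
        field_simp
        ring
      rw [hv] at hlim
      -- The normalised sum of conditional variances is the Cesàro mean of $1-\mathrm{drift}^2$.
      refine hlim.cesaro.congr fun n => ?_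
      simp_rw [ElephantWalk.condVarSum, h.condVar_distDiff]
      rw [div_eq_inv_mul])
  have hvis : ∀ n : ℕ, StronglyMeasurable fun ω =>
      ElephantWalk.visits (fun k => g k ω) n :=
    fun n => (ElephantWalk.dependsOn_visits n).stronglyMeasurable h.measurable_step
  have hR : ∀ n : ℕ, Measurable fun ω =>
      2 / (S.card : ℝ) * (ElephantWalk.visits (fun k => g k ω) n / √n) :=
    fun n => ((hvis n).measurable.div_const _).const_mul _
  -- Slutsky: the visit term tends to zero almost surely, hence in probability, and does not affect
  -- the limit law.
  refine tendstoInDistribution_of_tendstoInMeasure_sub _ _ hCLT ?_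
    fun n => (hCLT.forall_aemeasurable n).add (hR n).aemeasurable
  have hsub : ((fun (n : ℕ) ω => ElephantWalk.martSum (ElephantWalk.distDiff S p) n
      (fun k => g k ω) / √n + 2 / (S.card : ℝ) * (ElephantWalk.visits (fun k => g k ω) n / √n)) -
      fun (n : ℕ) ω => ElephantWalk.martSum (ElephantWalk.distDiff S p) n (fun k => g k ω) / √n) =
      fun (n : ℕ) ω => 2 / (S.card : ℝ) * (ElephantWalk.visits (fun k => g k ω) n / √n) := by
    ext n ω
    simp
  rw [hsub]
  refine tendstoInMeasure_of_tendsto_ae (fun n => (hR n).aestronglyMeasurable) ?_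
  filter_upwards [hae] with ω hω
  simpa using (ElephantWalk.tendsto_visits_div_sqrt hω.1).const_mul (2 / (S.card : ℝ))
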